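/- Let $0\le\alpha<1$, let $z\in\mathbb C$ with $\operatorname{Re} z>0$, and let $\Omega=\mathbb R$ or $\Omega=\mathbb T=\mathbb R/2\pi\mathbb Z$. Define $(-\Delta)^{\alpha/2}$ on $L^2(\Omega)$ (complex-valued) by $\mathcal F((-\Delta)^{\alpha/2}f)(\xi)=|\xi|^\alpha\mathcal F(f)(\xi)$ if $\Omega=\mathbb R$, where $\mathcal F f(\xi)=(2\pi)^{-1/2}\int_{\mathbb R} f(x)e^{-ix\xi}\,dx$, and by $c_n((-\Delta)^{\alpha/2}f)=|n|^\alpha c_n(f)$ for all $n\in\mathbb Z$ if $\Omega=\mathbb T$, where $c_n(f)$ is the $n$-th Fourier coefficient (with $0^0=1$, so that the operator is the identity for $\alpha=0$); its domain is the set of $f\in L^2(\Omega)$ for which the result is in $L^2(\Omega)$. Let $\omega\subset\Omega$ be an open set such that $\Omega\setminus\omega$ has nonempty interior, and let $T>0$. Then the rotated fractional heat equation $$(\partial_t+z(-\Delta)^{\alpha/2})f(t,x)=\mathbf 1_\omega u(t,x),\quad t\in(0,T),\ x\in\Omega,\qquad f(0,\cdot)=f_0,$$ is not null-controllable on $\omega$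 in time $T$. That is, it is not true that for every $f_0\in L^2(\Omega)$ there is a control $u\in L^2([0,T]\times\omega)$ such that the solution $f$ satisfies $f(T,\cdot)=0$. Here the solution is the weak one: $f\in C([0,T];L^2(\Omega))$, $f(0)=f_0$, and for all $\varphi$ in the domain of $(-\Delta)^{\alpha/2}$ and all $t\in[0,T]$, with $\langle\varphi,g\rangle=\int_\Omega\overline{\varphi}\,g$, $$\langle\varphi,f(t)\rangle-\langle\varphi,f_0\rangle=-z\int_0^t\langle(-\Delta)^{\alpha/2}\varphi,f(s)\rangle\,ds+\int_0^t\!\!\int_\omega\overline{\varphi(x)}\,u(s,x)\,dx\,ds.$$ -/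

import Mathlib

open MeasureTheory Set
open scoped FourierTransform

noncomputable section

instance instFactTwoPiPos : Fact (0 < 2 * Real.pi) := ⟨Real.two_pi_pos⟩

/-- The torus `ℝ / 2πℤ`, with the measure `volume` of total mass `2π`. -/
abbrev Torus : Type := AddCircle (2 * Real.pi)

/-- Complex-valued `L²(Ω)`. -/
abbrev L2 (Ω : Type*) [MeasureSpace Ω] : Type _ := Lp ℂ 2 (volume : Measure Ω)

/-- `φ ∈ L²(ℝ)` is in the domain of `(-Δ)^{α/2}` and `(-Δ)^{α/2} φ = ψ`.
Mathlib's Fourier transform on `L²(ℝ)` has the kernel `exp (-2πixξ)`, so that the frequency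
variable of the kernel `exp (-ixξ)` is `2πξ` and the multiplier is `|2πξ|^α`. -/
def IsFracLaplacianReal (α : ℝ) (φ ψ : L2 ℝ) : Prop :=
  ((𝓕 ψ : L2 ℝ) : ℝ → ℂ) =ᵐ[volume]
    fun ξ : ℝ => ((|2 * Real.pi * ξ| ^ α : ℝ) : ℂ) * ((𝓕 φ : L2 ℝ) : ℝ → ℂ) ξ

/-- `φ ∈ L²(𝕋)` is in the domain of `(-Δ)^{α/2}` and `(-Δ)^{α/2} φ = ψ`:
`c_n(ψ) = |n|^α c_n(φ)` for all `n` (with `0 ^ 0 = 1`, so that `α = 0` gives the identity). -/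
def IsFracLaplacianTorus (α : ℝ) (φ ψ : L2 Torus) : Prop :=
  ∀ n : ℤ, fourierCoeff (ψ : Torus → ℂ) n
    = ((|(n : ℝ)| ^ α : ℝ) : ℂ) * fourierCoeff (φ : Torus → ℂ) n

/-- Let `A` be the self-adjoint operator on `L²(Ω)` with graph `{(φ, ψ) | A φ ψ}`, and let
`u ∈ L²([0,T] × ω)`. `f` is a weak solution of
`∂ₜ f + z A f = 1_ω u` on `(0,T) × Ω`, `f(0) = f₀`: it lies in `C([0,T]; L²(Ω))`, and the equation,
integrated over `(0,t)` and tested against an arbitrary `φ` in the domain of `A`, reads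
`⟨φ, f(t)⟩ - ⟨φ, f₀⟩ = -z ∫₀ᵗ ⟨A φ, f(s)⟩ ds + ∫_{(0,t) × ω} conj(φ(x)) u(s,x) ds dx`. -/
structure IsWeakSolution {Ω : Type*} [MeasureSpace Ω] (A : L2 Ω → L2 Ω → Prop) (z : ℂ) (T : ℝ)
    (ω : Set Ω) (u : ℝ × Ω → ℂ) (f₀ : L2 Ω) (f : ℝ → L2 Ω) : Prop where
  continuousOn : ContinuousOn f (Icc 0 T)
  initial : f 0 = f₀
  weak : ∀ φ ψ : L2 Ω, A φ ψ → ∀ t ∈ Icc 0 T,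
    inner ℂ φ (f t) - inner ℂ φ f₀
      = -z * (∫ s in (0 : ℝ)..t, inner ℂ ψ (f s))
        + ∫ p in Ioc 0 t ×ˢ ω, star ((φ : Ω → ℂ) p.2) * u p ∂(volume.prod volume)

/-- Null-controllability on `ω` in time `T` of `∂ₜ f + z A f = 1_ω u`: every `f₀ ∈ L²(Ω)` is
steered to `0` at time `T` by some control `u ∈ L²([0,T] × ω)`. -/
def NullControllable {Ω : Type*} [MeasureSpace Ω] (A : L2 Ω → L2 Ω → Prop) (z : ℂ)
    (ω : Set Ω) (T : ℝ) : Prop :=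
  ∀ f₀ : L2 Ω, ∃ u : ℝ × Ω → ℂ,
    MemLp u 2 ((volume.restrict (Icc 0 T)).prod (volume.restrict ω)) ∧
    ∃ f : ℝ → L2 Ω, IsWeakSolution A z T ω u f₀ f ∧ f T = 0

end

/-! Null-controllability implies an observability inequality for the adjoint equation. For a
backward adjoint solution `φ`, pairing with a controlled solution that ends at `0` shows that `⟨φ 0,
f₀⟩` is, up to sign, the integral of `conj φ · u` over `(0,T) × ω`. If `φ n` is bounded on `ω` by `K
n` times a fixed L² weight, then each `⟨φ n 0, f₀⟩ / K n` is bounded in `n`, and Banach-Steinhaus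
gives `‖φ n 0‖ ≤ C * K n` (`NullControllable.exists_norm_le`). The theorem follows from adjoint
solutions that violate this.

These are wave packets centred at a point `x₀` of the interior of the complement of `ω`, with
frequency profile `r ^ N exp (-r) exp (-(T - s) conj z r ^ α)` on `r > 0`. At `s = 0` their norm is
at least a constant times `N ^ N exp (-N - 1) exp (-T Re z (N + 1) ^ α)`, which by Stirling is `N!`
up to a factor subexponential in `N`, because `α < 1`.

At distance `y` from `x₀`, the packet is a Laplace integral with complex rate `p = 1 - iy`.
Expanding the symbol in powers of `r ^ α`, each term is a Gamma integral equal to `Γ(σ) p ^ (-σ)`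
with `σ` real, so its modulus depends only on `‖p‖ = √(1 + y²)`. Resumming
(`HasFracExpansion.norm_packet_le_integral`) bounds the packet by a real Laplace integral of rate
`√(1 + y²)`. Since `exp (M r ^ α)` is subexponential, this is `O(N! / β ^ (N + 1))` for every `β <
√(1 + y²)`. Away from `x₀` one may take `β > 1`, and the exponential gain beats all subexponential
losses (`not_forall_packetMass_le`).

On the torus the packets are periodized, and Poisson summation transfers the bounds from the line.
`IsPacketSynthesis` collects what the common argument needs from either domain. -/

open MeasureTheory Set
open scoped FourierTransform

/-! ### Duality with the adjoint equation, and observability from null-controllability. -/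

section Duality

open Filter Topology ComplexConjugate

/-- A one-parameter family `φ s` of elements of `L²(Ω)`, represented by the functions `g s`, that
solves the adjoint equation `∂ₛ φ = conj z • A φ` up to an error `O(|t - s|²)` dominated by a fixed
weight `w`. The functions `h s` represent `A (φ s)`. -/
structure IsAdjointFamily {Ω : Type*} [MeasureSpace Ω] (A : L2 Ω → L2 Ω → Prop) (z : ℂ) (T : ℝ)
    (w : Ω → ℝ) (g h : ℝ → Ω → ℂ) (φ ψ : ℝ → L2 Ω) (L : ℝ) : Prop where
  stronglyMeasurable : StronglyMeasurable (Function.uncurry g)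
  coe_ae_eq : ∀ s, (φ s : Ω → ℂ) =ᵐ[volume] g s
  coe_ae_eq' : ∀ s, (ψ s : Ω → ℂ) =ᵐ[volume] h s
  graph : ∀ s, A (φ s) (ψ s)
  nonneg : 0 ≤ L
  norm_le : ∀ s ∈ Icc 0 T, ∀ x, ‖g s x‖ ≤ L * w x
  norm_le' : ∀ s ∈ Icc 0 T, ∀ x, ‖h s x‖ ≤ L * w x
  norm_sub_le : ∀ s ∈ Icc 0 T, ∀ t ∈ Icc 0 T, ∀ x,
    ‖g t x - g s x - ((t - s : ℝ) : ℂ) * (conj z * h s x)‖ ≤ L * (t - s) ^ 2 * w x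

lemma setIntegral_Ioc_prod_sub {Ω : Type*} [MeasureSpace Ω] [SFinite (volume : Measure Ω)]
    {E : Type*} [NormedAddCommGroup E] [NormedSpace ℝ E]
    {ω : Set Ω} (hω : MeasurableSet ω) {T : ℝ} {F : ℝ × Ω → E}
    (hF : IntegrableOn F (Ioc 0 T ×ˢ ω) (volume.prod volume)) {s t : ℝ} (hs : 0 ≤ s) (hst : s ≤ t)
    (ht : t ≤ T) :
    ∫ p in Ioc 0 t ×ˢ ω, F p ∂(volume.prod volume) - ∫ p in Ioc 0 s ×ˢ ω, F p ∂(volume.prod volume)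
      = ∫ p in Ioc s t ×ˢ ω, F p ∂(volume.prod volume) := by
  rw [← Ioc_union_Ioc_eq_Ioc hs hst, union_prod, setIntegral_union]
  · abel
  · exact Disjoint.set_prod_left (Ioc_disjoint_Ioc_of_le le_rfl) _ _
  · exact measurableSet_Ioc.prod hω
  · exact hF.mono_set (prod_mono (Ioc_subset_Ioc le_rfl (hst.trans ht)) le_rfl)
  · exact hF.mono_set (prod_mono (Ioc_subset_Ioc hs ht) le_rfl)

lemma integrableOn_mul_of_memLp {Ω : Type*} [MeasureSpace Ω] [SFinite (volume : Measure Ω)]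
    {ω : Set Ω} {T : ℝ} {u : ℝ × Ω → ℂ}
    (hu : MemLp u 2 ((volume.restrict (Icc 0 T)).prod (volume.restrict ω)))
    {w : Ω → ℝ} (hw : MemLp w 2 volume) :
    IntegrableOn (fun p : ℝ × Ω => w p.2 * ‖u p‖) (Ioc 0 T ×ˢ ω) (volume.prod volume) := by
  have h1 := (hw.restrict ω).comp_snd (volume.restrict (Icc (0 : ℝ) T))
  have h2 := h1.integrable_mul hu.norm
  rw [Measure.prod_restrict] at h2
  exact IntegrableOn.mono_set h2 (prod_mono Ioc_subset_Icc_self le_rfl)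

/-- The control is only square integrable in time, so the increments of the control term are not
`O(t - s)`; uniform continuity of this primitive makes them small. -/
lemma continuousOn_setIntegral_Ioc_prod {Ω : Type*} [MeasureSpace Ω] [SFinite (volume : Measure Ω)]
    {ω : Set Ω} {T : ℝ} (hT : 0 ≤ T) {F : ℝ × Ω → ℝ}
    (hF : IntegrableOn F (Ioc 0 T ×ˢ ω) (volume.prod volume)) :
    ContinuousOn (fun t => ∫ p in Ioc 0 t ×ˢ ω, F p ∂(volume.prod volume)) (Icc 0 T) := by
  have h1 : IntegrableOn (fun r => ∫ x in ω, F (r, x)) (uIcc 0 T) := by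
    rw [uIcc_of_le hT, integrableOn_Icc_iff_integrableOn_Ioc]
    rw [IntegrableOn, ← Measure.prod_restrict] at hF
    exact hF.integral_prod_left
  have h2 := intervalIntegral.continuousOn_primitive_interval h1
  rw [uIcc_of_le hT] at h2
  refine h2.congr fun t ht => ?_
  simp only
  rw [setIntegral_prod _ (hF.mono_set (prod_mono (Ioc_subset_Ioc le_rfl ht.2) le_rfl)),
    intervalIntegral.integral_of_le ht.1]

variable {Ω : Type*} [MeasureSpace Ω] {A : L2 Ω → L2 Ω → Prop}
  {z : ℂ} {T : ℝ} {w : Ω → ℝ} {g h : ℝ → Ω → ℂ} {φ ψ : ℝ → L2 Ω} {L : ℝ} {ω : Set Ω}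
  {u : ℝ × Ω → ℂ} {f₀ : L2 Ω} {f : ℝ → L2 Ω}

lemma IsAdjointFamily.norm_sub_le_mul (H : IsAdjointFamily A z T w g h φ ψ L) (hw0 : ∀ x, 0 ≤ w x)
    {s t : ℝ} (hs : s ∈ Icc 0 T) (ht : t ∈ Icc 0 T) (x : Ω) :
    ‖g t x - g s x‖ ≤ L * (T + ‖z‖) * |t - s| * w x := by
  have h1 := H.norm_sub_le s hs t ht x
  have h2 : ‖((t - s : ℝ) : ℂ) * (conj z * h s x)‖ ≤ |t - s| * (‖z‖ * (L * w x)) := by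
    rw [norm_mul, norm_mul, Complex.norm_real, RCLike.norm_conj, Real.norm_eq_abs]
    gcongr
    exact H.norm_le' s hs x
  have h3 : ‖g t x - g s x‖ ≤ ‖g t x - g s x - ((t - s : ℝ) : ℂ) * (conj z * h s x)‖
      + ‖((t - s : ℝ) : ℂ) * (conj z * h s x)‖ := by
    simpa using norm_add_le (g t x - g s x - ((t - s : ℝ) : ℂ) * (conj z * h s x))
      (((t - s : ℝ) : ℂ) * (conj z * h s x))
  have h4 : L * (t - s) ^ 2 * w x ≤ L * (T * |t - s|) * w x := by
    have : (t - s) ^ 2 ≤ T * |t - s| := by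
      rw [← sq_abs, sq]
      gcongr
      rw [abs_le]
      constructor <;> linarith [hs.1, hs.2, ht.1, ht.2]
    have := H.nonneg
    have := hw0 x
    gcongr
  nlinarith

lemma IsAdjointFamily.norm_remainder_le (H : IsAdjointFamily A z T w g h φ ψ L)
    (hw : MemLp w 2 volume) {s t : ℝ} (hs : s ∈ Icc 0 T) (ht : t ∈ Icc 0 T) :
    ‖φ t - φ s - ((t - s : ℝ) : ℂ) • conj z • ψ s‖ ≤ L * (t - s) ^ 2 * ‖hw.toLp w‖ := by
  refine Lp.norm_le_mul_norm_of_ae_le_mul ?_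
  filter_upwards [H.coe_ae_eq s, H.coe_ae_eq t, H.coe_ae_eq' s, hw.coeFn_toLp,
    Lp.coeFn_sub (φ t - φ s) (((t - s : ℝ) : ℂ) • conj z • ψ s), Lp.coeFn_sub (φ t) (φ s),
    Lp.coeFn_smul ((t - s : ℝ) : ℂ) (conj z • ψ s), Lp.coeFn_smul (conj z) (ψ s)]
    with x h1 h2 h3 h4 h5 h6 h7 h8
  rw [h5, Pi.sub_apply, h6, Pi.sub_apply, h7, Pi.smul_apply, h8, Pi.smul_apply, h1, h2, h3, h4,
    smul_eq_mul, smul_eq_mul, Real.norm_eq_abs]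
  refine (H.norm_sub_le s hs t ht x).trans ?_
  have := H.nonneg
  gcongr
  exact le_abs_self _

lemma IsAdjointFamily.norm_graph_le (H : IsAdjointFamily A z T w g h φ ψ L)
    (hw : MemLp w 2 volume) {s : ℝ} (hs : s ∈ Icc 0 T) :
    ‖ψ s‖ ≤ L * ‖hw.toLp w‖ := by
  refine Lp.norm_le_mul_norm_of_ae_le_mul ?_
  filter_upwards [H.coe_ae_eq' s, hw.coeFn_toLp] with x h3 h4
  rw [h3, h4, Real.norm_eq_abs]
  refine (H.norm_le' s hs x).trans ?_
  have := H.nonneg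
  gcongr
  exact le_abs_self _

variable [SFinite (volume : Measure Ω)]

lemma integrableOn_star_mul {w : Ω → ℝ} (hw : MemLp w 2 volume) (hω : MeasurableSet ω)
    (hu : MemLp u 2 ((volume.restrict (Icc 0 T)).prod (volume.restrict ω)))
    {G : ℝ → Ω → ℂ} (hG : StronglyMeasurable (Function.uncurry G)) {C : ℝ}
    (hGw : ∀ s ∈ Icc 0 T, ∀ x, ‖G s x‖ ≤ C * w x) :
    IntegrableOn (fun p : ℝ × Ω => star (G p.1 p.2) * u p) (Ioc 0 T ×ˢ ω)
      (volume.prod volume) := by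
  refine Integrable.mono' ((integrableOn_mul_of_memLp hu hw).const_mul C) ?_ ?_
  · refine AEStronglyMeasurable.mul ?_ ?_
    · exact (continuous_star.comp_stronglyMeasurable hG).aestronglyMeasurable
    · have := hu.1
      rw [Measure.prod_restrict] at this
      exact this.mono_set (prod_mono Ioc_subset_Icc_self le_rfl)
  · refine (ae_restrict_iff' (measurableSet_Ioc.prod hω)).2 (Eventually.of_forall fun p hp => ?_)
    rw [norm_mul, norm_star, ← mul_assoc]
    gcongr
    exact hGw _ (Ioc_subset_Icc_self hp.1) _

/-- The weak formulation only admits test functions constant in time, so `φ s` is frozen on `[s,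
t]`. The first-order change of `φ` then cancels the drift of `f`. Each of the three remaining terms
contains a factor of order `t - s` and a second factor that tends to zero with `t - s`. -/
lemma IsAdjointFamily.increment_eq (H : IsAdjointFamily A z T w g h φ ψ L)
    (hw : MemLp w 2 volume) (hω : MeasurableSet ω)
    (hu : MemLp u 2 ((volume.restrict (Icc 0 T)).prod (volume.restrict ω)))
    (hf : IsWeakSolution A z T ω u f₀ f) {s t : ℝ} (hs : 0 ≤ s) (hst : s ≤ t) (ht : t ≤ T) :
    inner ℂ (φ t) (f t) - inner ℂ (φ s) (f s)
        - ∫ p in Ioc s t ×ˢ ω, star (g p.1 p.2) * u p ∂(volume.prod volume)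
      = inner ℂ (φ t - φ s - ((t - s : ℝ) : ℂ) • conj z • ψ s) (f t)
        + z * (∫ r in s..t, inner ℂ (ψ s) (f t - f r))
        + ∫ p in Ioc s t ×ˢ ω, star (g s p.2 - g p.1 p.2) * u p ∂(volume.prod volume) := by
  have hsT : s ∈ Icc 0 T := ⟨hs, hst.trans ht⟩
  have htT : t ∈ Icc 0 T := ⟨hs.trans hst, ht⟩
  have i1 := integrableOn_star_mul hw hω hu H.stronglyMeasurable H.norm_le
  have gs : StronglyMeasurable (Function.uncurry fun _ : ℝ => g s) :=
    H.stronglyMeasurable.comp_measurable (measurable_const.prodMk measurable_snd)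
  have i2 : IntegrableOn (fun p : ℝ × Ω => star (g s p.2) * u p) (Ioc 0 T ×ˢ ω)
      (volume.prod volume) :=
    integrableOn_star_mul hw hω hu gs (fun r _ x => H.norm_le s hsT x)
  have mono : Ioc s t ×ˢ ω ⊆ Ioc 0 T ×ˢ ω := prod_mono (Ioc_subset_Ioc hs ht) le_rfl
  have ci : ∀ a ∈ Icc 0 T, ∀ b ∈ Icc 0 T,
      IntervalIntegrable (fun r => inner ℂ (ψ s) (f r)) volume a b := fun a ha b hb => by
    refine ContinuousOn.intervalIntegrable ?_
    exact (continuousOn_const.inner hf.continuousOn).mono (uIcc_subset_Icc ha hb)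
  have e1 : ∀ a, ∫ p in Ioc 0 a ×ˢ ω, star ((φ s : Ω → ℂ) p.2) * u p ∂(volume.prod volume)
      = ∫ p in Ioc 0 a ×ˢ ω, star (g s p.2) * u p ∂(volume.prod volume) := fun a => by
    refine integral_congr_ae (ae_restrict_of_ae ?_)
    filter_upwards [Measure.quasiMeasurePreserving_snd.ae_eq_comp (H.coe_ae_eq s)] with p hp
    simp only [Function.comp_apply] at hp
    rw [hp]
  have w1 := hf.weak _ _ (H.graph s) t htT
  have w2 := hf.weak _ _ (H.graph s) s hsT
  rw [e1] at w1 w2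
  have w3 := setIntegral_Ioc_prod_sub hω i2 hs hst ht
  have z0 : (0 : ℝ) ∈ Icc 0 T := ⟨le_rfl, hs.trans hsT.2⟩
  have w4 := intervalIntegral.integral_interval_sub_left (ci 0 z0 t htT) (ci 0 z0 s hsT)
  have w5 : ∫ p in Ioc s t ×ˢ ω, star (g s p.2 - g p.1 p.2) * u p ∂(volume.prod volume)
      = (∫ p in Ioc s t ×ˢ ω, star (g s p.2) * u p ∂(volume.prod volume))
        - ∫ p in Ioc s t ×ˢ ω, star (g p.1 p.2) * u p ∂(volume.prod volume) := by
    rw [← integral_sub (i2.mono_set mono) (i1.mono_set mono)]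
    simp only [star_sub, sub_mul]
  have w6 : ∫ r in s..t, inner ℂ (ψ s) (f t - f r)
      = ((t - s : ℝ) : ℂ) * inner ℂ (ψ s) (f t) - ∫ r in s..t, inner ℂ (ψ s) (f r) := by
    simp only [inner_sub_right]
    rw [intervalIntegral.integral_sub (by simp) (ci s hsT t htT)]
    simp
  rw [w5, w6, inner_sub_left, inner_sub_left, inner_smul_left, inner_smul_left, ← w4, ← w3]
  simp only [Complex.conj_conj, Complex.conj_ofReal]
  linear_combination w1 - w2

/-- Here `η` is a common modulus for the oscillation of `f`, the weighted mass of the control on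
`[s, t]` and the length `t - s`, so that the defect is `o(t - s)`. -/
lemma IsAdjointFamily.norm_increment_le (H : IsAdjointFamily A z T w g h φ ψ L)
    (hw : MemLp w 2 volume) (hw0 : ∀ x, 0 ≤ w x) (hω : MeasurableSet ω)
    (hu : MemLp u 2 ((volume.restrict (Icc 0 T)).prod (volume.restrict ω)))
    (hf : IsWeakSolution A z T ω u f₀ f) {B η : ℝ} (hB : ∀ t ∈ Icc 0 T, ‖f t‖ ≤ B)
    {s t : ℝ} (hs : 0 ≤ s) (hst : s ≤ t) (ht : t ≤ T) (hη : ∀ r ∈ Icc s t, ‖f t - f r‖ ≤ η)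
    (hη' : ∫ p in Ioc s t ×ˢ ω, w p.2 * ‖u p‖ ∂(volume.prod volume) ≤ η) (hη'' : t - s ≤ η) :
    ‖inner ℂ (φ t) (f t) - inner ℂ (φ s) (f s)
        - ∫ p in Ioc s t ×ˢ ω, star (g p.1 p.2) * u p ∂(volume.prod volume)‖
      ≤ (L * ‖hw.toLp w‖ * B + ‖z‖ * (L * ‖hw.toLp w‖) + L * (T + ‖z‖)) * η * (t - s) := by
  have hsT : s ∈ Icc 0 T := ⟨hs, hst.trans ht⟩
  have htT : t ∈ Icc 0 T := ⟨hs.trans hst, ht⟩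
  have hL := H.nonneg
  have hB0 : 0 ≤ B := (norm_nonneg _).trans (hB s hsT)
  have hts : 0 ≤ t - s := sub_nonneg.2 hst
  have hη0 : 0 ≤ η := hts.trans hη''
  rw [H.increment_eq hw hω hu hf hs hst ht]
  refine (norm_add₃_le).trans ?_
  have b1 : ‖inner ℂ (φ t - φ s - ((t - s : ℝ) : ℂ) • conj z • ψ s) (f t)‖
      ≤ L * (η * (t - s)) * ‖hw.toLp w‖ * B := by
    refine (norm_inner_le_norm _ _).trans ?_
    gcongr
    · refine (H.norm_remainder_le hw hsT htT).trans ?_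
      rw [sq]
      gcongr
    · exact hB t htT
  have b2 : ‖z * (∫ r in s..t, inner ℂ (ψ s) (f t - f r))‖
      ≤ ‖z‖ * ((L * ‖hw.toLp w‖) * η * (t - s)) := by
    rw [norm_mul]
    gcongr
    refine (intervalIntegral.norm_integral_le_of_norm_le_const
      (C := (L * ‖hw.toLp w‖) * η) fun r hr => ?_).trans ?_
    · rw [uIoc_of_le hst] at hr
      refine (norm_inner_le_norm _ _).trans ?_
      gcongr
      · exact H.norm_graph_le hw hsT
      · exact hη r (Ioc_subset_Icc_self hr)
    · rw [abs_of_nonneg hts]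
  have b3 : ‖∫ p in Ioc s t ×ˢ ω, star (g s p.2 - g p.1 p.2) * u p ∂(volume.prod volume)‖
      ≤ L * (T + ‖z‖) * (t - s) * η := by
    have i0 := (integrableOn_mul_of_memLp hu hw).mono_set
      (prod_mono (Ioc_subset_Ioc hs ht) (le_refl ω))
    refine (norm_integral_le_of_norm_le (i0.const_mul (L * (T + ‖z‖) * (t - s)))
      ?_).trans ?_
    · refine (ae_restrict_iff' (measurableSet_Ioc.prod hω)).2 (Eventually.of_forall fun p hp => ?_)
      have hp1 : p.1 ∈ Icc s t := Ioc_subset_Icc_self hp.1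
      rw [norm_mul, norm_star, ← mul_assoc]
      gcongr
      refine (H.norm_sub_le_mul hw0 ⟨hs.trans hp1.1, hp1.2.trans ht⟩ hsT p.2).trans ?_
      have := hw0 p.2
      have : 0 ≤ T := htT.1.trans htT.2
      gcongr
      rw [abs_sub_comm, abs_of_nonneg (sub_nonneg.2 hp1.1)]
      linarith [hp1.2]
    · rw [integral_const_mul]
      have : 0 ≤ T := htT.1.trans htT.2
      gcongr
  linarith

/-- Duality between the controlled equation and the adjoint equation. -/
theorem IsAdjointFamily.inner_sub_inner_eq (H : IsAdjointFamily A z T w g h φ ψ L) (hT : 0 ≤ T)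
    (hw : MemLp w 2 volume) (hw0 : ∀ x, 0 ≤ w x) (hω : MeasurableSet ω)
    (hu : MemLp u 2 ((volume.restrict (Icc 0 T)).prod (volume.restrict ω)))
    (hf : IsWeakSolution A z T ω u f₀ f) :
    inner ℂ (φ T) (f T) - inner ℂ (φ 0) f₀
      = ∫ p in Ioc 0 T ×ˢ ω, star (g p.1 p.2) * u p ∂(volume.prod volume) := by
  set Φ : ℝ → ℂ := fun t => inner ℂ (φ t) (f t)
    - ∫ p in Ioc 0 t ×ˢ ω, star (g p.1 p.2) * u p ∂(volume.prod volume) with hΦ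
  have i1 := integrableOn_star_mul hw hω hu H.stronglyMeasurable H.norm_le
  have i2 := integrableOn_mul_of_memLp hu hw
  obtain ⟨B, hB⟩ := isCompact_Icc.exists_bound_of_continuousOn hf.continuousOn
  have uc1 := isCompact_Icc.uniformContinuousOn_of_continuous hf.continuousOn
  have uc2 := isCompact_Icc.uniformContinuousOn_of_continuous
    (continuousOn_setIntegral_Ioc_prod hT i2)
  rw [Metric.uniformContinuousOn_iff] at uc1 uc2
  set K := L * ‖hw.toLp w‖ * B + ‖z‖ * (L * ‖hw.toLp w‖) + L * (T + ‖z‖) with hK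
  have key : ∀ η > 0, ∃ δ > 0, ∀ s t, 0 ≤ s → s ≤ t → t ≤ T → t - s < δ →
      ‖Φ t - Φ s‖ ≤ K * η * (t - s) := by
    intro η hη
    obtain ⟨δ₁, hδ₁, H1⟩ := uc1 η hη
    obtain ⟨δ₂, hδ₂, H2⟩ := uc2 η hη
    refine ⟨min η (min δ₁ δ₂), by positivity, fun s t hs hst ht hδ => ?_⟩
    rw [lt_min_iff, lt_min_iff] at hδ
    have hsT : s ∈ Icc 0 T := ⟨hs, hst.trans ht⟩
    have htT : t ∈ Icc 0 T := ⟨hs.trans hst, ht⟩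
    have e : Φ t - Φ s = inner ℂ (φ t) (f t) - inner ℂ (φ s) (f s)
        - ∫ p in Ioc s t ×ˢ ω, star (g p.1 p.2) * u p ∂(volume.prod volume) := by
      rw [← setIntegral_Ioc_prod_sub hω i1 hs hst ht]
      simp only [hΦ]
      ring
    rw [e]
    refine H.norm_increment_le hw hw0 hω hu hf hB hs hst ht (fun r hr => ?_) ?_ hδ.1.le
    · rw [← dist_eq_norm]
      refine (H1 t htT r ⟨hs.trans hr.1, hr.2.trans ht⟩ ?_).le
      rw [Real.dist_eq, abs_of_nonneg (sub_nonneg.2 hr.2)]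
      linarith [hr.1]
    · rw [← setIntegral_Ioc_prod_sub hω i2 hs hst ht]
      refine (le_abs_self _).trans ?_
      rw [← Real.dist_eq]
      refine (H2 t htT s hsT ?_).le
      rw [Real.dist_eq, abs_of_nonneg (sub_nonneg.2 hst)]
      exact hδ.2.2
  -- The increments of `Φ` are `o(t - s)` on both sides, hence `Φ` has zero derivative and is
  -- constant.
  have hder : ∀ s ∈ Icc 0 T, HasDerivWithinAt Φ 0 (Icc 0 T) s := by
    intro s hs
    rw [hasDerivWithinAt_iff_isLittleO, Asymptotics.isLittleO_iff]
    intro c hc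
    have hK1 : 0 < |K| + 1 := by positivity
    obtain ⟨δ, hδ, H1⟩ := key (c / (|K| + 1)) (by positivity)
    have hKc : K * (c / (|K| + 1)) ≤ c := by
      rw [mul_div_assoc', div_le_iff₀ hK1]
      nlinarith [le_abs_self K]
    filter_upwards [self_mem_nhdsWithin, mem_nhdsWithin_of_mem_nhds (Metric.ball_mem_nhds s hδ)]
      with t ht htδ
    rw [smul_zero, sub_zero, Real.norm_eq_abs]
    rw [Metric.mem_ball, Real.dist_eq] at htδ
    rcases le_total s t with hst | hst
    · rw [abs_of_nonneg (sub_nonneg.2 hst)] at htδ ⊢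
      refine (H1 s t hs.1 hst ht.2 htδ).trans ?_
      exact mul_le_mul_of_nonneg_right hKc (sub_nonneg.2 hst)
    · rw [abs_sub_comm, abs_of_nonneg (sub_nonneg.2 hst)] at htδ ⊢
      rw [norm_sub_rev]
      refine (H1 t s ht.1 hst hs.2 htδ).trans ?_
      exact mul_le_mul_of_nonneg_right hKc (sub_nonneg.2 hst)
  have hconst : Φ T = Φ 0 := by
    rcases hT.eq_or_lt with rfl | hT'
    · rfl
    refine constant_of_derivWithin_zero (fun s hs => (hder s hs).differentiableWithinAt)
      (fun s hs => ?_) T ⟨hT, le_rfl⟩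
    exact (hder s (Ico_subset_Icc_self hs)).derivWithin
      (uniqueDiffOn_Icc hT' s (Ico_subset_Icc_self hs))
  simp only [hΦ, Ioc_self, empty_prod, Measure.restrict_empty, integral_zero_measure,
    sub_zero, hf.initial] at hconst
  rw [← hconst]
  ring

/-- If the equation is null-controllable, then a sequence of solutions of the adjoint equation
cannot be negligible on `ω` with respect to its final value. -/
theorem NullControllable.exists_norm_le (hc : NullControllable A z ω T) (hT : 0 ≤ T)
    (hω : MeasurableSet ω) {w : Ω → ℝ} (hw : MemLp w 2 volume) (hw0 : ∀ x, 0 ≤ w x)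
    {g h : ℕ → ℝ → Ω → ℂ} {φ ψ : ℕ → ℝ → L2 Ω} {L K : ℕ → ℝ}
    (H : ∀ n, IsAdjointFamily A z T w (g n) (h n) (φ n) (ψ n) (L n)) (hK : ∀ n, 0 < K n)
    (hgK : ∀ n, ∀ s ∈ Icc 0 T, ∀ x ∈ ω, ‖g n s x‖ ≤ K n * w x) :
    ∃ C : ℝ, ∀ n, ‖φ n 0‖ ≤ C * K n := by
  -- The control may depend on `f₀` in an arbitrary way; pointwise bounds on the rescaled
  -- functionals suffice for the uniform boundedness principle.
  have hbound : ∀ f₀ : L2 Ω, ∃ C, ∀ n,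
      ‖(innerSL ℂ ((((K n)⁻¹ : ℝ) : ℂ) • φ n 0)) f₀‖ ≤ C := by
    intro f₀
    obtain ⟨u, hu, f, hf, hfT⟩ := hc f₀
    refine ⟨∫ p in Ioc 0 T ×ˢ ω, w p.2 * ‖u p‖ ∂(volume.prod volume), fun n => ?_⟩
    have e := (H n).inner_sub_inner_eq hT hw hw0 hω hu hf
    rw [hfT, inner_zero_right, zero_sub] at e
    have i2 := integrableOn_mul_of_memLp hu hw
    have b : ‖inner ℂ (φ n 0) f₀‖
        ≤ K n * ∫ p in Ioc 0 T ×ˢ ω, w p.2 * ‖u p‖ ∂(volume.prod volume) := by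
      rw [← norm_neg, e, ← integral_const_mul]
      refine norm_integral_le_of_norm_le (i2.const_mul (K n)) ?_
      refine (ae_restrict_iff' (measurableSet_Ioc.prod hω)).2 (Eventually.of_forall fun p hp => ?_)
      rw [norm_mul, norm_star, ← mul_assoc]
      gcongr
      exact hgK n _ (Ioc_subset_Icc_self hp.1) _ hp.2
    rw [innerSL_apply_apply, inner_smul_left, norm_mul, RCLike.norm_conj, Complex.norm_real,
      Real.norm_eq_abs, abs_of_pos (inv_pos.2 (hK n)), inv_mul_le_iff₀ (hK n)]
    exact b
  obtain ⟨C, hC⟩ := banach_steinhaus hbound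
  refine ⟨C, fun n => ?_⟩
  have := hC n
  rw [innerSL_apply_norm, norm_smul, Complex.norm_real, Real.norm_eq_abs,
    abs_of_pos (inv_pos.2 (hK n)), inv_mul_le_iff₀ (hK n)] at this
  linarith

end Duality

/-! ### Gamma integrals with complex rate, and expansions in powers of `r ^ α`. -/

section Laplace

open Filter Topology

lemma integrableOn_rpow_mul_exp_neg {s b : ℝ} (hs : 0 < s) (hb : 0 < b) :
    IntegrableOn (fun r : ℝ => r ^ (s - 1) * Real.exp (-(b * r))) (Ioi 0) := by
  have := integrableOn_rpow_mul_exp_neg_mul_rpow (s := s - 1) (p := 1) (by linarith) one_pos hb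
  simpa using this

lemma aestronglyMeasurable_rpow_mul_cexp (s : ℝ) (p : ℂ) :
    AEStronglyMeasurable (fun r : ℝ => ((r ^ (s - 1) : ℝ) : ℂ) * Complex.exp (-(p * r)))
      (volume.restrict (Ioi 0)) := by
  refine Measurable.aestronglyMeasurable ?_
  fun_prop

lemma norm_cexp_neg_mul_ofReal (p : ℂ) (r : ℝ) :
    ‖Complex.exp (-(p * r))‖ = Real.exp (-(p.re * r)) := by
  rw [Complex.norm_exp]
  simp

lemma integrableOn_rpow_mul_cexp {s : ℝ} (hs : 0 < s) {p : ℂ} (hp : 0 < p.re) :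
    IntegrableOn (fun r : ℝ => ((r ^ (s - 1) : ℝ) : ℂ) * Complex.exp (-(p * r))) (Ioi 0) := by
  refine Integrable.mono' (integrableOn_rpow_mul_exp_neg hs hp)
    (aestronglyMeasurable_rpow_mul_cexp s p) ?_
  refine (ae_restrict_iff' measurableSet_Ioi).2 (Eventually.of_forall fun r hr => ?_)
  rw [norm_mul, norm_cexp_neg_mul_ofReal, Complex.norm_real, Real.norm_eq_abs,
    abs_of_nonneg (Real.rpow_nonneg (le_of_lt hr) _)]

lemma differentiableOn_integral_rpow_mul_cexp {s : ℝ} (hs : 0 < s) :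
    DifferentiableOn ℂ (fun p : ℂ => ∫ r in Ioi (0 : ℝ),
      ((r ^ (s - 1) : ℝ) : ℂ) * Complex.exp (-(p * r))) {p | 0 < p.re} := by
  intro p hp
  rw [mem_ofPred_eq] at hp
  have hball : ∀ q ∈ Metric.ball p (p.re / 2), p.re / 2 < q.re := fun q hq => by
    rw [Metric.mem_ball, dist_eq_norm] at hq
    have := (Complex.abs_re_le_norm (q - p)).trans_lt hq
    rw [Complex.sub_re, abs_lt] at this
    linarith
  have hD := hasDerivAt_integral_of_dominated_loc_of_deriv_le (μ := volume.restrict (Ioi (0 : ℝ)))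
    (F := fun p r => ((r ^ (s - 1) : ℝ) : ℂ) * Complex.exp (-(p * r)))
    (F' := fun p r => ((r ^ (s - 1) : ℝ) : ℂ) * (Complex.exp (-(p * r)) * -(r : ℂ)))
    (x₀ := p) (bound := fun r => r ^ (s + 1 - 1) * Real.exp (-(p.re / 2 * r)))
    (Metric.ball_mem_nhds p (half_pos hp))
    (Eventually.of_forall fun q => aestronglyMeasurable_rpow_mul_cexp s q)
    (integrableOn_rpow_mul_cexp hs hp) (Measurable.aestronglyMeasurable (by fun_prop))
    ?_ (integrableOn_rpow_mul_exp_neg (by linarith) (half_pos hp)) ?_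
  · exact hD.2.differentiableAt.differentiableWithinAt
  · refine (ae_restrict_iff' measurableSet_Ioi).2 (Eventually.of_forall fun r hr q hq => ?_)
    have hr' : (0 : ℝ) < r := hr
    rw [norm_mul, norm_mul, norm_cexp_neg_mul_ofReal, Complex.norm_real, Real.norm_eq_abs,
      abs_of_nonneg (Real.rpow_nonneg hr'.le _), norm_neg, Complex.norm_real, Real.norm_eq_abs,
      abs_of_pos hr', show s + 1 - 1 = (s - 1) + 1 by ring, Real.rpow_add_one hr'.ne',
      mul_comm (Real.exp _), ← mul_assoc]
    gcongr
    exact (hball q hq).le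
  · refine Eventually.of_forall fun r q hq => ?_
    refine HasDerivAt.const_mul _ ?_
    have : HasDerivAt (fun q : ℂ => -(q * (r : ℂ))) (-(1 * (r : ℂ))) q :=
      ((hasDerivAt_id q).mul_const (r : ℂ)).neg
    rw [one_mul] at this
    exact this.cexp

/-- Both sides are analytic in the right half-plane and agree for positive real `p`; the points `1 +
1/(n + 1)` accumulate at `1`, so the identity theorem applies. -/
lemma integral_rpow_mul_cexp {s : ℝ} (hs : 0 < s) {p : ℂ} (hp : 0 < p.re) :
    ∫ r in Ioi (0 : ℝ), ((r ^ (s - 1) : ℝ) : ℂ) * Complex.exp (-(p * r))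
      = Real.Gamma s * p ^ (((-s : ℝ)) : ℂ) := by
  have ho : IsOpen {p : ℂ | 0 < p.re} := isOpen_lt continuous_const Complex.continuous_re
  have h1 := (differentiableOn_integral_rpow_mul_cexp hs).analyticOnNhd ho
  have h2 : AnalyticOnNhd ℂ (fun p : ℂ => Real.Gamma s * p ^ (((-s : ℝ)) : ℂ))
      {p | 0 < p.re} := by
    refine DifferentiableOn.analyticOnNhd (fun q hq => ?_) ho
    refine DifferentiableAt.differentiableWithinAt ?_
    exact (differentiableAt_id.cpow_const (Or.inl hq)).const_mul _
  have hconn : IsPreconnected {p : ℂ | 0 < p.re} :=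
    (convex_halfSpace_re_gt 0).isPreconnected
  refine h1.eqOn_of_preconnected_of_frequently_eq h2 hconn (z₀ := 1) (by simp) ?_ hp
  have hreal : ∀ b : ℝ, 0 < b →
      ∫ r in Ioi (0 : ℝ), ((r ^ (s - 1) : ℝ) : ℂ) * Complex.exp (-((b : ℂ) * r))
        = Real.Gamma s * (b : ℂ) ^ (((-s : ℝ)) : ℂ) := by
    intro b hb
    have := Real.integral_rpow_mul_exp_neg_mul_Ioi hs hb
    rw [← Complex.ofReal_cpow hb.le, ← Complex.ofReal_mul, Real.rpow_neg hb.le,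
      ← Real.inv_rpow hb.le, mul_comm, ← one_div, ← this, ← integral_complex_ofReal]
    simp
  have htend : Tendsto (fun n : ℕ => (((1 : ℝ) + 1 / ((n : ℝ) + 1) : ℝ) : ℂ)) atTop
      (𝓝[≠] (1 : ℂ)) := by
    refine tendsto_nhdsWithin_iff.2 ⟨?_, Eventually.of_forall fun n => ?_⟩
    · have : Tendsto (fun n : ℕ => (1 : ℝ) + 1 / ((n : ℝ) + 1)) atTop (𝓝 (1 + 0)) :=
        tendsto_const_nhds.add tendsto_one_div_add_atTop_nhds_zero_nat
      rw [add_zero] at this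
      exact_mod_cast (Complex.continuous_ofReal.tendsto 1).comp this
    · have : (1 : ℝ) / ((n : ℝ) + 1) ≠ 0 := by positivity
      rw [mem_compl_iff, mem_singleton_iff]
      intro h
      have h' : (1 : ℝ) + 1 / ((n : ℝ) + 1) = 1 := Complex.ofReal_injective (by simpa using h)
      exact this (by linarith)
  exact htend.frequently (Frequently.of_forall fun n => hreal _ (by positivity))

/-- As the exponent is real, `‖p ^ (-s)‖ = ‖p‖ ^ (-s)`. Oscillation thus improves the rate from `Re
p` to `‖p‖`, without loss of constants. -/
lemma norm_integral_rpow_mul_cexp {s : ℝ} (hs : 0 < s) {p : ℂ} (hp : 0 < p.re) :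
    ‖∫ r in Ioi (0 : ℝ), ((r ^ (s - 1) : ℝ) : ℂ) * Complex.exp (-(p * r))‖
      = ∫ r in Ioi (0 : ℝ), r ^ (s - 1) * Real.exp (-(‖p‖ * r)) := by
  have hp0 : 0 < ‖p‖ := hp.trans_le ((le_abs_self _).trans (Complex.abs_re_le_norm p))
  rw [integral_rpow_mul_cexp hs hp, Real.integral_rpow_mul_exp_neg_mul_Ioi hs hp0, norm_mul,
    Complex.norm_cpow_real, Complex.norm_real, Real.norm_eq_abs,
    abs_of_pos (Real.Gamma_pos_of_pos hs), Real.rpow_neg hp0.le, ← Real.inv_rpow hp0.le, one_div,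
    mul_comm]

/-- This is where `α < 1` enters: `r ^ α` is sublinear, so `exp (M r ^ α)` costs an arbitrarily
small exponential rate. -/
lemma exists_mul_rpow_le {α : ℝ} (hα0 : 0 ≤ α) (hα1 : α < 1) (M : ℝ) {ε : ℝ} (hε : 0 < ε) :
    ∃ C, ∀ r : ℝ, 0 ≤ r → M * r ^ α ≤ ε * r + C := by
  have h1 : Tendsto (fun r : ℝ => |M| * r ^ (-(1 - α))) atTop (𝓝 (|M| * 0)) :=
    (tendsto_rpow_neg_atTop (by linarith)).const_mul _
  rw [mul_zero] at h1
  obtain ⟨R, hR⟩ := eventually_atTop.1 ((h1.eventually_lt_const hε).and (eventually_gt_atTop 0))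
  refine ⟨|M| * (max R 0) ^ α, fun r hr => ?_⟩
  have hM : M * r ^ α ≤ |M| * r ^ α := by
    gcongr
    exact le_abs_self M
  refine hM.trans ?_
  rcases le_total R r with h | h
  · obtain ⟨h2, h3⟩ := hR r h
    have h4 : r ^ α = r ^ (-(1 - α)) * r := by
      rw [← Real.rpow_add_one h3.ne']
      congr 1
      ring
    have : 0 ≤ |M| * (max R 0) ^ α := by positivity
    rw [h4, ← mul_assoc]
    nlinarith
  · have : r ^ α ≤ (max R 0) ^ α := by
      gcongr
      exact h.trans (le_max_left _ _)
    have : |M| * r ^ α ≤ |M| * (max R 0) ^ α := by gcongr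
    have : 0 ≤ ε * r := by positivity
    linarith

/-- `F` has on `(0, ∞)` a convergent expansion in powers of `r ^ α`, with coefficients dominated by
those of `D * exp (M * r ^ α)`. -/
def HasFracExpansion (α M D : ℝ) (F : ℝ → ℂ) : Prop :=
  0 ≤ D ∧ 0 ≤ M ∧ Measurable F ∧ ∃ c : ℕ → ℂ, (∀ k, ‖c k‖ ≤ D * (M ^ k / k.factorial)) ∧
    ∀ r : ℝ, 0 < r → HasSum (fun k => c k * (((r ^ α) ^ k : ℝ) : ℂ)) (F r)

lemma hasSum_pow_div_factorial (D M ρ : ℝ) :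
    HasSum (fun k : ℕ => D * (M ^ k / k.factorial) * ρ ^ k) (D * Real.exp (M * ρ)) := by
  have := (NormedSpace.expSeries_div_hasSum_exp (M * ρ)).mul_left D
  rw [← Real.exp_eq_exp_ℝ] at this
  refine this.congr_fun fun k => ?_
  rw [mul_pow]
  ring

lemma HasFracExpansion.norm_le {α M D : ℝ} {F : ℝ → ℂ} (hF : HasFracExpansion α M D F) {r : ℝ}
    (hr : 0 < r) : ‖F r‖ ≤ D * Real.exp (M * r ^ α) := by
  obtain ⟨hD, hM, -, c, hc, hs⟩ := hF
  rw [← (hs r hr).tsum_eq, ← (hasSum_pow_div_factorial D M (r ^ α)).tsum_eq]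
  refine tsum_of_norm_bounded (hasSum_pow_div_factorial D M (r ^ α)).summable.hasSum fun k => ?_
  rw [norm_mul, Complex.norm_real, Real.norm_eq_abs, abs_of_nonneg (by positivity)]
  gcongr
  exact hc k

end Laplace

/-! ### Decay of wave packets away from their centre. -/

noncomputable section Packet

open Filter Topology

/-- The Laplace-Fourier integral `∫₀^∞ r ^ N exp (-(1 - iy) r) F(r) dr`. -/
def packet (N : ℕ) (F : ℝ → ℂ) (y : ℝ) : ℂ :=
  ∫ r in Ioi (0 : ℝ), (r : ℂ) ^ N * Complex.exp (-((1 - y * Complex.I) * r)) * F r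

lemma integrableOn_pow_mul_exp_mul_exp_rpow {α : ℝ} (hα0 : 0 ≤ α) (hα1 : α < 1) (N : ℕ) (M : ℝ)
    {b : ℝ} (hb : 0 < b) :
    IntegrableOn (fun r : ℝ => r ^ N * Real.exp (-(b * r)) * Real.exp (M * r ^ α)) (Ioi 0) := by
  obtain ⟨C, hC⟩ := exists_mul_rpow_le hα0 hα1 M (half_pos hb)
  have h1 := (integrableOn_rpow_mul_exp_neg (s := N + 1) (by positivity) (half_pos hb)).const_mul
    (Real.exp C)
  refine Integrable.mono' h1 (Measurable.aestronglyMeasurable (by fun_prop)) ?_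
  refine (ae_restrict_iff' measurableSet_Ioi).2 (Eventually.of_forall fun r hr => ?_)
  have hr' : (0 : ℝ) < r := hr
  rw [Real.norm_eq_abs, abs_of_nonneg (by positivity), add_sub_cancel_right, Real.rpow_natCast,
    mul_assoc, ← Real.exp_add, mul_left_comm, ← Real.exp_add]
  refine mul_le_mul_of_nonneg_left (Real.exp_le_exp.2 ?_) (by positivity)
  linarith [hC r hr'.le]

lemma HasFracExpansion.norm_integrand_le {α M D : ℝ} {F : ℝ → ℂ} (hF : HasFracExpansion α M D F)
    (N : ℕ) (y : ℝ) {r : ℝ} (hr : 0 < r) :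
    ‖(r : ℂ) ^ N * Complex.exp (-((1 - y * Complex.I) * r)) * F r‖
      ≤ D * (r ^ N * Real.exp (-(1 * r)) * Real.exp (M * r ^ α)) := by
  rw [norm_mul, norm_mul, norm_cexp_neg_mul_ofReal, norm_pow, Complex.norm_real, Real.norm_eq_abs,
    abs_of_pos hr]
  have e : (1 - (y : ℂ) * Complex.I).re = 1 := by simp
  rw [e, mul_left_comm D]
  gcongr
  exact hF.norm_le hr

lemma HasFracExpansion.integrableOn {α M D : ℝ} (hα0 : 0 ≤ α) (hα1 : α < 1) {F : ℝ → ℂ}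
    (hF : HasFracExpansion α M D F) (N : ℕ) (y : ℝ) :
    IntegrableOn (fun r : ℝ => (r : ℂ) ^ N * Complex.exp (-((1 - y * Complex.I) * r)) * F r)
      (Ioi 0) := by
  refine Integrable.mono' ((integrableOn_pow_mul_exp_mul_exp_rpow hα0 hα1 N M one_pos).const_mul D)
    ?_ ?_
  · have := hF.2.2.1
    exact Measurable.aestronglyMeasurable (by fun_prop)
  · exact (ae_restrict_iff' measurableSet_Ioi).2
      (Eventually.of_forall fun r hr => hF.norm_integrand_le N y hr)

/-- The partial sums of the exponential series lie below the exponential. The bound serves twice: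
with `b = 1` to exchange sum and integral, and with `b = ‖p‖` to resum the moduli. -/
lemma sum_mul_integral_le {α M D b : ℝ} (hα0 : 0 ≤ α) (hα1 : α < 1) (hD : 0 ≤ D) (hM : 0 ≤ M)
    (hb : 0 < b) (N n : ℕ) :
    ∑ k ∈ Finset.range n, D * (M ^ k / k.factorial)
        * ∫ r in Ioi (0 : ℝ), r ^ (N + α * k + 1 - 1) * Real.exp (-(b * r))
      ≤ D * ∫ r in Ioi (0 : ℝ), r ^ N * Real.exp (-(b * r)) * Real.exp (M * r ^ α) := by
  have hs : ∀ k : ℕ, 0 < (N : ℝ) + α * k + 1 := fun k => by positivity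
  simp_rw [← integral_const_mul]
  rw [← integral_finsetSum _ fun k _ => (integrableOn_rpow_mul_exp_neg (hs k) hb).const_mul _]
  refine setIntegral_mono_on
    (integrable_finsetSum _ fun k _ => (integrableOn_rpow_mul_exp_neg (hs k) hb).const_mul _)
    ((integrableOn_pow_mul_exp_mul_exp_rpow hα0 hα1 N M hb).const_mul D) measurableSet_Ioi ?_
  intro r hr
  have hr' : (0 : ℝ) < r := hr
  have h1 := sum_le_hasSum (Finset.range n) (fun k _ => by positivity)
    (hasSum_pow_div_factorial D M (r ^ α))
  have h2 : ∀ k : ℕ, D * (M ^ k / k.factorial) * (r ^ (N + α * k + 1 - 1) * Real.exp (-(b * r)))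
      = (D * (M ^ k / k.factorial) * (r ^ α) ^ k) * (r ^ N * Real.exp (-(b * r))) := by
    intro k
    rw [add_sub_cancel_right, Real.rpow_add hr', Real.rpow_natCast, Real.rpow_mul hr'.le,
      Real.rpow_natCast]
    ring
  simp_rw [h2]
  rw [← Finset.sum_mul]
  calc _ ≤ D * Real.exp (M * r ^ α) * (r ^ N * Real.exp (-(b * r))) := by gcongr
    _ = _ := by ring

lemma norm_one_sub_mul_I (y : ℝ) : ‖1 - (y : ℂ) * Complex.I‖ = √(1 + y ^ 2) := by
  rw [Complex.norm_def, Complex.normSq_apply]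
  congr 1
  simp
  ring

lemma HasFracExpansion.norm_packet_le_integral {α M D : ℝ} (hα0 : 0 ≤ α) (hα1 : α < 1) {F : ℝ → ℂ}
    (hF : HasFracExpansion α M D F) (N : ℕ) (y : ℝ) :
    ‖packet N F y‖ ≤ D * ∫ r in Ioi (0 : ℝ),
      r ^ N * Real.exp (-(√(1 + y ^ 2) * r)) * Real.exp (M * r ^ α) := by
  obtain ⟨hD, hM, -, c, hc, hs⟩ := hF
  set p : ℂ := 1 - y * Complex.I with hp
  have hpre : 0 < p.re := by simp [hp]
  have hre : p.re = 1 := by simp [hp]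
  have hpn : 0 < ‖p‖ := hpre.trans_le ((le_abs_self _).trans (Complex.abs_re_le_norm p))
  rw [← norm_one_sub_mul_I, ← hp]
  have hs0 : ∀ k : ℕ, 0 < (N : ℝ) + α * k + 1 := fun k => by positivity
  set G : ℕ → ℝ → ℂ := fun k r =>
    c k * (((r ^ ((N : ℝ) + α * k + 1 - 1) : ℝ) : ℂ) * Complex.exp (-(p * r))) with hG
  have hGi : ∀ k, Integrable (G k) (volume.restrict (Ioi 0)) := fun k =>
    (integrableOn_rpow_mul_cexp (hs0 k) hpre).const_mul _
  have hGs : ∀ r ∈ Ioi (0 : ℝ), HasSum (fun k => G k r)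
      ((r : ℂ) ^ N * Complex.exp (-(p * r)) * F r) := by
    intro r hr
    have hr' : (0 : ℝ) < r := hr
    refine ((hs r hr').mul_left ((r : ℂ) ^ N * Complex.exp (-(p * r)))).congr_fun fun k => ?_
    simp only [hG]
    rw [add_sub_cancel_right, Real.rpow_add hr', Real.rpow_natCast, Real.rpow_mul hr'.le,
      Real.rpow_natCast]
    push_cast
    ring
  have hnorm : ∀ k, ∫ r in Ioi (0 : ℝ), ‖G k r‖ ≤ D * (M ^ k / k.factorial)
      * ∫ r in Ioi (0 : ℝ), r ^ (N + α * k + 1 - 1) * Real.exp (-(1 * r)) := by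
    intro k
    rw [← integral_const_mul]
    refine setIntegral_mono_on (hGi k).norm
      ((integrableOn_rpow_mul_exp_neg (hs0 k) one_pos).const_mul _) measurableSet_Ioi fun r hr => ?_
    simp only [hG]
    rw [norm_mul, norm_mul, norm_cexp_neg_mul_ofReal, hre, Complex.norm_real, Real.norm_eq_abs,
      abs_of_nonneg (Real.rpow_nonneg (le_of_lt hr) _)]
    gcongr
    · exact mul_nonneg (Real.rpow_nonneg (le_of_lt hr) _) (Real.exp_nonneg _)
    · exact hc k
  have hI0 : ∀ (b : ℝ) (k : ℕ), 0 ≤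
      ∫ r in Ioi (0 : ℝ), r ^ (N + α * k + 1 - 1) * Real.exp (-(b * r)) := fun b k =>
    setIntegral_nonneg measurableSet_Ioi fun r hr =>
      mul_nonneg (Real.rpow_nonneg (le_of_lt hr) _) (Real.exp_nonneg _)
  have hsum1 : Summable fun k => ∫ r in Ioi (0 : ℝ), ‖G k r‖ :=
    Summable.of_nonneg_of_le (fun k => integral_nonneg fun r => norm_nonneg _) hnorm
      (summable_of_sum_range_le (fun k => mul_nonneg (by positivity) (hI0 _ _))
        (sum_mul_integral_le hα0 hα1 hD hM one_pos N))
  have hsum := hasSum_integral_of_summable_integral_norm hGi hsum1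
  have hpk : packet N F y = ∫ r in Ioi (0 : ℝ), ∑' k, G k r := by
    refine setIntegral_congr_fun measurableSet_Ioi fun r hr => ?_
    exact (hGs r hr).tsum_eq.symm
  rw [hpk, ← hsum.tsum_eq]
  -- The modulus is taken after integrating each term, which replaces the rate `Re p = 1` by `‖p‖`.
  have hle : ∀ k, ‖∫ r in Ioi (0 : ℝ), G k r‖ ≤ D * (M ^ k / k.factorial)
      * ∫ r in Ioi (0 : ℝ), r ^ (N + α * k + 1 - 1) * Real.exp (-(‖p‖ * r)) := by
    intro k
    simp only [hG]
    rw [integral_const_mul, norm_mul, norm_integral_rpow_mul_cexp (hs0 k) hpre]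
    exact mul_le_mul_of_nonneg_right (hc k) (hI0 _ _)
  have hsum2 := summable_of_sum_range_le (fun k => mul_nonneg (by positivity) (hI0 ‖p‖ k))
    (sum_mul_integral_le hα0 hα1 hD hM hpn N)
  exact (tsum_of_norm_bounded hsum2.hasSum hle).trans
    (Real.tsum_le_of_sum_range_le (fun k => mul_nonneg (by positivity) (hI0 ‖p‖ k))
      (sum_mul_integral_le hα0 hα1 hD hM hpn N))

lemma integral_pow_mul_exp_neg (N : ℕ) {b : ℝ} (hb : 0 < b) :
    ∫ r in Ioi (0 : ℝ), r ^ N * Real.exp (-(b * r)) = N.factorial / b ^ (N + 1) := by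
  have := Real.integral_rpow_mul_exp_neg_mul_Ioi (a := N + 1) (by positivity) hb
  rw [Real.Gamma_nat_eq_factorial] at this
  simp only [add_sub_cancel_right, Real.rpow_natCast] at this
  rw [this, show (N : ℝ) + 1 = ((N + 1 : ℕ) : ℝ) by push_cast; ring, Real.rpow_natCast,
    div_pow, one_pow]
  field_simp

/-- Decay of `packet N F` outside of `{y | √(1 + y²) < b}`. -/
lemma exists_norm_packet_le {α : ℝ} (hα0 : 0 ≤ α) (hα1 : α < 1) (M : ℝ) {b β : ℝ}
    (hβ : 0 < β) (hβb : β < b) :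
    ∃ C > 0, ∀ (D : ℝ) (F : ℝ → ℂ), HasFracExpansion α M D F → ∀ N : ℕ, 1 ≤ N → ∀ y : ℝ,
      b ≤ √(1 + y ^ 2) → ‖packet N F y‖ ≤ D * (C * N.factorial / β ^ (N + 1)) * (1 + y ^ 2)⁻¹ := by
  obtain ⟨C, hC⟩ := exists_mul_rpow_le hα0 hα1 M (sub_pos.2 hβb)
  have hb : 0 < b := hβ.trans hβb
  refine ⟨Real.exp C * b ^ 2, by positivity, fun D F hF N hN y hy => ?_⟩
  set ρ := √(1 + y ^ 2) with hρ
  have hρ0 : 0 < ρ := hb.trans_le hy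
  refine (hF.norm_packet_le_integral hα0 hα1 N y).trans ?_
  rw [← hρ, mul_assoc D]
  have hD := hF.1
  gcongr
  -- The rate given up is proportional to `ρ`: the rate kept is `β ρ / b`, and since `ρ ≥ b` the
  -- remainder is at least `b - β`, enough to absorb `M r ^ α`.
  have hβ' : 0 < β * (ρ / b) := by positivity
  have hle : β * (ρ / b) + (b - β) ≤ ρ := by
    have h1 : 1 ≤ ρ / b := (one_le_div hb).2 hy
    have h2 : b * (ρ / b) = ρ := by field_simp
    nlinarith
  calc ∫ r in Ioi (0 : ℝ), r ^ N * Real.exp (-(ρ * r)) * Real.exp (M * r ^ α)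
      ≤ ∫ r in Ioi (0 : ℝ), Real.exp C * (r ^ N * Real.exp (-(β * (ρ / b) * r))) := by
        refine setIntegral_mono_on (integrableOn_pow_mul_exp_mul_exp_rpow hα0 hα1 N M hρ0)
          ?_ measurableSet_Ioi fun r hr => ?_
        · have := (integrableOn_rpow_mul_exp_neg (s := N + 1) (by positivity) hβ').const_mul
            (Real.exp C)
          simpa [IntegrableOn] using this
        · have hr' : (0 : ℝ) < r := hr
          rw [mul_assoc, ← Real.exp_add, mul_left_comm, ← Real.exp_add]
          refine mul_le_mul_of_nonneg_left (Real.exp_le_exp.2 ?_) (by positivity)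
          nlinarith [hC r hr'.le]
    _ = Real.exp C * (N.factorial / (β ^ (N + 1))) * (b / ρ) ^ (N + 1) := by
        rw [integral_const_mul, integral_pow_mul_exp_neg N hβ', mul_pow, div_pow, div_pow]
        field_simp
    _ ≤ Real.exp C * (N.factorial / (β ^ (N + 1))) * (b / ρ) ^ 2 := by
        refine mul_le_mul_of_nonneg_left ?_ (by positivity)
        -- Two of the `N + 1 ≥ 2` factors `b / ρ` are kept, to produce the decay `(1 + y²)⁻¹`.
        exact pow_le_pow_of_le_one (by positivity) ((div_le_one hρ0).2 hy) (by omega)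
    _ = Real.exp C * b ^ 2 * N.factorial / β ^ (N + 1) * (1 + y ^ 2)⁻¹ := by
        have : ρ ^ 2 = 1 + y ^ 2 := Real.sq_sqrt (by positivity)
        rw [div_pow, this]
        field_simp

end Packet

/-! ### The symbols of the adjoint semigroup, and comparison of factorials. -/

noncomputable section Family

open Filter Topology ComplexConjugate

/-- This is the second-order Taylor remainder of a monomial. A bound geometric in `k` is what is
needed: divided by `k!`, it makes the remainder of `exp (a r ^ α)` an expansion of the same class,
with a factor `‖b - a‖ ^ 2`. -/
lemma norm_pow_sub_pow_le {M : ℝ} {a b : ℂ} (ha : ‖a‖ ≤ M) (hb : ‖b‖ ≤ M) (k : ℕ) :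
    ‖b ^ k - a ^ k - (b - a) * (k * a ^ (k - 1))‖ ≤ ‖b - a‖ ^ 2 * (M + 1) ^ k := by
  have hM : 0 ≤ M := (norm_nonneg _).trans ha
  have hk : ∀ k : ℕ, ‖(k : ℂ) * a ^ (k - 1)‖ ≤ (M + 1) ^ k := by
    intro k
    induction k with
    | zero => simp
    | succ k ih =>
      rcases k with - | k
      · simpa using hM
      have e : (((k + 1 + 1 : ℕ)) : ℂ) * a ^ (k + 1 + 1 - 1)
          = a * (((k + 1 : ℕ) : ℂ) * a ^ (k + 1 - 1)) + a ^ (k + 1) := by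
        simp only [Nat.add_sub_cancel]
        push_cast
        ring
      rw [e]
      refine (norm_add_le _ _).trans ?_
      rw [norm_mul, norm_pow]
      have h1 : ‖a‖ * ‖((k + 1 : ℕ) : ℂ) * a ^ (k + 1 - 1)‖ ≤ M * (M + 1) ^ (k + 1) := by gcongr
      have h2 : ‖a‖ ^ (k + 1) ≤ (M + 1) ^ (k + 1) := by
        gcongr
        linarith
      rw [pow_succ (M + 1) (k + 1)]
      linarith
  induction k with
  | zero => simp
  | succ k ih =>
    have e : b ^ (k + 1) - a ^ (k + 1) - (b - a) * (((k + 1 : ℕ) : ℂ) * a ^ (k + 1 - 1))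
        = b * (b ^ k - a ^ k - (b - a) * (k * a ^ (k - 1))) + (b - a) ^ 2 * (k * a ^ (k - 1)) := by
      rcases k with - | k
      · simp
      · simp only [Nat.add_sub_cancel]
        push_cast
        ring
    rw [e]
    refine (norm_add_le _ _).trans ?_
    rw [norm_mul, norm_mul, norm_pow]
    calc _ ≤ M * (‖b - a‖ ^ 2 * (M + 1) ^ k) + ‖b - a‖ ^ 2 * (M + 1) ^ k := by
          gcongr
          exact hk k
      _ = _ := by ring

/-- The symbol `exp (a r ^ α)`. -/
def fracExp (α : ℝ) (a : ℂ) (r : ℝ) : ℂ := Complex.exp (a * ((r ^ α : ℝ) : ℂ))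

/-- The symbol `r ^ α exp (a r ^ α)`. -/
def rpowMulFracExp (α : ℝ) (a : ℂ) (r : ℝ) : ℂ := ((r ^ α : ℝ) : ℂ) * fracExp α a r

lemma measurable_fracExp (α : ℝ) (a : ℂ) : Measurable (fracExp α a) := by
  unfold fracExp
  fun_prop

lemma measurable_rpowMulFracExp (α : ℝ) (a : ℂ) : Measurable (rpowMulFracExp α a) := by
  have := measurable_fracExp α a
  unfold rpowMulFracExp
  fun_prop

lemma hasSum_fracExp (α : ℝ) (a : ℂ) (r : ℝ) :
    HasSum (fun k : ℕ => a ^ k / k.factorial * (((r ^ α) ^ k : ℝ) : ℂ)) (fracExp α a r) := by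
  have := NormedSpace.expSeries_div_hasSum_exp (a * ((r ^ α : ℝ) : ℂ))
  rw [← Complex.exp_eq_exp_ℂ] at this
  refine this.congr_fun fun k => ?_
  rw [mul_pow]
  push_cast
  ring

lemma hasSum_rpowMulFracExp (α : ℝ) (a : ℂ) (r : ℝ) :
    HasSum (fun k : ℕ => k * a ^ (k - 1) / k.factorial * (((r ^ α) ^ k : ℝ) : ℂ))
      (rpowMulFracExp α a r) := by
  rw [← hasSum_nat_add_iff' 1]
  simp only [Finset.range_one, Finset.sum_singleton, Nat.cast_zero, zero_mul, zero_div, sub_zero]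
  refine ((hasSum_fracExp α a r).mul_left ((r ^ α : ℝ) : ℂ)).congr_fun fun k => ?_
  have h1 : (k.factorial : ℂ) ≠ 0 := by exact_mod_cast k.factorial_ne_zero
  have h2 : (k : ℂ) + 1 ≠ 0 := by exact_mod_cast k.succ_ne_zero
  rw [Nat.add_sub_cancel, Nat.factorial_succ]
  push_cast
  field_simp
  ring

lemma hasFracExpansion_fracExp (α : ℝ) {M : ℝ} {a : ℂ} (ha : ‖a‖ ≤ M) :
    HasFracExpansion α (M + 1) 1 (fracExp α a) := by
  have hM : 0 ≤ M := (norm_nonneg _).trans ha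
  refine ⟨zero_le_one, by positivity, measurable_fracExp α a, fun k => a ^ k / k.factorial,
    fun k => ?_, fun r _ => hasSum_fracExp α a r⟩
  rw [norm_div, norm_pow, one_mul, Complex.norm_natCast]
  gcongr
  linarith

lemma hasFracExpansion_remainder (α : ℝ) {M : ℝ} {a b : ℂ} (ha : ‖a‖ ≤ M) (hb : ‖b‖ ≤ M) :
    HasFracExpansion α (M + 1) (‖b - a‖ ^ 2)
      (fun r => fracExp α b r - fracExp α a r - (b - a) * rpowMulFracExp α a r) := by
  have hM : 0 ≤ M := (norm_nonneg _).trans ha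
  refine ⟨by positivity, by positivity, ((measurable_fracExp α b).sub (measurable_fracExp α a)).sub
    ((measurable_rpowMulFracExp α a).const_mul _),
    fun k => (b ^ k - a ^ k - (b - a) * (k * a ^ (k - 1))) / k.factorial,
    fun k => ?_, fun r _ => ?_⟩
  · rw [norm_div, mul_div_assoc', Complex.norm_natCast]
    gcongr
    exact norm_pow_sub_pow_le ha hb k
  · refine (((hasSum_fracExp α b r).sub (hasSum_fracExp α a r)).sub
      ((hasSum_rpowMulFracExp α a r).mul_left (b - a))).congr_fun fun k => ?_
    ring

lemma hasFracExpansion_rpowMulFracExp (α : ℝ) {M : ℝ} {a : ℂ} (ha : ‖a‖ ≤ M) :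
    HasFracExpansion α (M + 2) 3 (rpowMulFracExp α a) := by
  have hM : 0 ≤ M := (norm_nonneg _).trans ha
  refine ⟨by norm_num, by positivity, measurable_rpowMulFracExp α a,
    fun k => k * a ^ (k - 1) / k.factorial, fun k => ?_, fun r _ => hasSum_rpowMulFracExp α a r⟩
  rw [norm_div, mul_div_assoc', Complex.norm_natCast]
  gcongr
  -- The derivative `k a ^ (k - 1)` is recovered from the Taylor remainder between `a` and `a + 1`;
  -- its three terms account for the constant `3`.
  have ha1 : ‖a + 1‖ ≤ M + 1 := (norm_add_le _ _).trans (by simpa using ha)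
  have h1 := norm_pow_sub_pow_le (ha.trans (by linarith : M ≤ M + 1)) ha1 k
  have e : (k : ℂ) * a ^ (k - 1) = (a + 1) ^ k - a ^ k
      - ((a + 1) ^ k - a ^ k - (a + 1 - a) * (k * a ^ (k - 1))) := by ring
  rw [e]
  refine (norm_sub_le _ _).trans ((add_le_add (norm_sub_le _ _) h1).trans ?_)
  rw [add_sub_cancel_left, norm_one, norm_pow, norm_pow]
  have h2 : ‖a + 1‖ ^ k ≤ (M + 2) ^ k := by
    gcongr
    linarith
  have h3 : ‖a‖ ^ k ≤ (M + 2) ^ k := by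
    gcongr
    linarith
  have h4 : (M + 1 + 1) ^ k = (M + 2) ^ k := by ring
  rw [h4]
  have : 0 ≤ (M + 2) ^ k := by positivity
  linarith

lemma HasFracExpansion.mono {α M M' D D' : ℝ} {F : ℝ → ℂ} (hF : HasFracExpansion α M D F)
    (hM : M ≤ M') (hD : D ≤ D') : HasFracExpansion α M' D' F := by
  obtain ⟨hD0, hM0, hm, c, hc, hs⟩ := hF
  refine ⟨hD0.trans hD, hM0.trans hM, hm, c, fun k => (hc k).trans ?_, hs⟩
  gcongr
  exact hD0.trans hD

/-- The Stirling sequence is decreasing, so it is bounded by its value at `1`. -/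
lemma factorial_le_stirling (N : ℕ) :
    ((N + 1).factorial : ℝ) ≤ Real.exp 1 * √(N + 1) * ((N + 1) / Real.exp 1) ^ (N + 1) := by
  have h1 := Stirling.stirlingSeq'_antitone (Nat.zero_le N)
  simp only [Function.comp_apply, Nat.succ_eq_add_one, zero_add, Stirling.stirlingSeq_one] at h1
  rw [Stirling.stirlingSeq, div_le_iff₀ (by positivity)] at h1
  refine h1.trans_eq ?_
  push_cast
  rw [Real.sqrt_mul (by norm_num)]
  field_simp

/-- The lower bound for the mass of a packet at the frequency `N`. -/
def packetMass (α m : ℝ) (N : ℕ) : ℝ :=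
  N ^ N * Real.exp (-(N + 1)) * Real.exp (-(m * (N + 1) ^ α))

lemma not_forall_packetMass_le {α : ℝ} (hα0 : 0 ≤ α) (hα1 : α < 1) (m C : ℝ) {β : ℝ}
    (hβ : 1 < β) :
    ¬ ∀ N : ℕ, packetMass α m (N + 1) ≤ C * ((N + 1).factorial / β ^ (N + 1 + 1)) := by
  intro H
  obtain ⟨C', hC'⟩ := exists_mul_rpow_le hα0 hα1 m (half_pos (Real.log_pos hβ))
  -- Write `β = q²`. One factor `q ^ (N + 2)` absorbs `exp (m (N + 2) ^ α)`; the other beats the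
  -- polynomial factor from Stirling.
  set q := Real.exp (Real.log β / 2) with hq
  have hq1 : 1 < q := Real.one_lt_exp_iff.2 (half_pos (Real.log_pos hβ))
  have hβq : β = q * q := by
    rw [hq, ← Real.exp_add, add_halves, Real.exp_log (by linarith)]
  have hC0 : 0 ≤ C := by
    by_contra hneg
    push Not at hneg
    have h1 := H 0
    have h2 : 0 < packetMass α m (0 + 1) := by
      unfold packetMass
      positivity
    have h3 : C * ((0 + 1).factorial / β ^ (0 + 1 + 1)) ≤ 0 :=
      mul_nonpos_of_nonpos_of_nonneg hneg.le (by positivity)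
    linarith
  have key : ∀ N : ℕ, 1 ≤ C * Real.exp 2 * Real.exp C' * ((N : ℝ) + 2) ^ 1 / q ^ (N + 2) := by
    intro N
    have h1 := H N
    have h2 := factorial_le_stirling N
    have h3 : Real.exp (-(Real.log β / 2 * (N + 2) + C')) ≤ Real.exp (-(m * ((N : ℝ) + 2) ^ α)) := by
      refine Real.exp_le_exp.2 (neg_le_neg (hC' _ (by positivity)))
    have h4 : Real.exp (-(Real.log β / 2 * (N + 2) + C')) = (q ^ (N + 2))⁻¹ * (Real.exp C')⁻¹ := by
      rw [neg_add, Real.exp_add, Real.exp_neg, Real.exp_neg, hq, ← Real.exp_nat_mul]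
      congr 3
      push_cast
      ring
    have h5 : √((N : ℝ) + 1) ≤ N + 2 := by
      rw [Real.sqrt_le_left (by positivity)]
      nlinarith [(Nat.cast_nonneg N : (0 : ℝ) ≤ N)]
    have h6 : Real.exp (-((N : ℝ) + 2)) = (Real.exp 1)⁻¹ * ((Real.exp 1) ^ (N + 1))⁻¹ := by
      rw [← Real.exp_neg, ← Real.exp_nat_mul, ← Real.exp_neg, ← Real.exp_add]
      congr 1
      push_cast
      ring
    unfold packetMass at h1
    push_cast at h1
    rw [show (N : ℝ) + 1 + 1 = N + 2 by ring] at h1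
    rw [h4] at h3
    have h7 : ((N : ℝ) + 1) ^ (N + 1) * Real.exp (-((N : ℝ) + 2))
          * ((q ^ (N + 2))⁻¹ * (Real.exp C')⁻¹)
        ≤ C * ((Real.exp 1 * (N + 2) * ((N + 1) / Real.exp 1) ^ (N + 1)) / β ^ (N + 2)) := by
      calc _ ≤ ((N : ℝ) + 1) ^ (N + 1) * Real.exp (-((N : ℝ) + 2))
            * Real.exp (-(m * ((N : ℝ) + 2) ^ α)) := by gcongr
        _ ≤ C * ((N + 1).factorial / β ^ (N + 2)) := h1
        _ ≤ C * ((Real.exp 1 * √(N + 1) * ((N + 1) / Real.exp 1) ^ (N + 1)) / β ^ (N + 2)) := by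
          gcongr
        _ ≤ _ := by gcongr
    rw [h6, hβq, mul_pow, div_pow] at h7
    have h8 : Real.exp 2 = Real.exp 1 * Real.exp 1 := by
      rw [← Real.exp_add]
      norm_num
    rw [h8, pow_one, one_le_div (by positivity)]
    have hpos : 0 < ((N : ℝ) + 1) ^ (N + 1) := by positivity
    field_simp at h7
    refine le_of_mul_le_mul_left ?_ hpos
    nlinarith
  have hlim : Tendsto (fun N : ℕ => C * Real.exp 2 * Real.exp C'
      * (((N + 2 : ℕ) : ℝ) ^ 1 / q ^ (N + 2))) atTop
      (𝓝 (C * Real.exp 2 * Real.exp C' * 0)) := by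
    exact ((tendsto_pow_const_div_const_pow_of_one_lt 1 hq1).comp
      (tendsto_add_atTop_nat 2)).const_mul _
  rw [mul_zero] at hlim
  have := ge_of_tendsto' hlim fun N => by
    have := key N
    push_cast
    rwa [mul_div_assoc] at this
  linarith

end Family

/-! ### The abstract argument: packets that are small on `ω` contradict null-controllability. -/

section Synthesis

open Filter Topology ComplexConjugate

/-- `S N F` is the function on `Ω` with the frequency profile `r ^ N exp (-r) F(r)`, `r > 0`. It is
dominated by the weight `w`, it is small on `ω`, and `A` acts on it by multiplication of `F` by
`r ^ α`. -/
structure IsPacketSynthesis {Ω : Type*} [MeasureSpace Ω] (A : L2 Ω → L2 Ω → Prop) (ω : Set Ω)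
    (w : Ω → ℝ) (α : ℝ) (S : ℕ → (ℝ → ℂ) → Ω → ℂ) : Prop where
  aestronglyMeasurable : ∀ N M D F, HasFracExpansion α M D F →
    AEStronglyMeasurable (S (N + 1) F) volume
  linear : ∀ N F G H c, (∃ M D, HasFracExpansion α M D F) → (∃ M D, HasFracExpansion α M D G) →
    (∃ M D, HasFracExpansion α M D H) → ∀ x,
    S (N + 1) (fun r => F r - G r - c * H r) x = S (N + 1) F x - S (N + 1) G x - c * S (N + 1) H x
  stronglyMeasurable : ∀ N (a : ℝ → ℂ), Continuous a →
    StronglyMeasurable (Function.uncurry fun s x => S (N + 1) (fracExp α (a s)) x)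
  norm_le : ∀ N M, ∃ C, 0 ≤ C ∧ ∀ D F, HasFracExpansion α M D F → ∀ x,
    ‖S (N + 1) F x‖ ≤ D * C * w x
  norm_le_of_mem : ∃ β, 1 < β ∧ ∀ M, ∃ C, 0 < C ∧ ∀ N F, HasFracExpansion α M 1 F → ∀ x ∈ ω,
    ‖S (N + 1) F x‖ ≤ C * ((N + 1).factorial / β ^ (N + 1 + 1)) * w x
  graph : ∀ N a (φ ψ : L2 Ω), (φ : Ω → ℂ) =ᵐ[volume] S (N + 1) (fracExp α a) →
    (ψ : Ω → ℂ) =ᵐ[volume] S (N + 1) (rpowMulFracExp α a) → A φ ψ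
  le_norm : ∃ c, 0 < c ∧ ∀ N (a : ℂ) (φ : L2 Ω), a.re ≤ 0 →
    (φ : Ω → ℂ) =ᵐ[volume] S (N + 1) (fracExp α a) → c * packetMass α (-a.re) (N + 1) ≤ ‖φ‖

variable {Ω : Type*} [MeasureSpace Ω] {A : L2 Ω → L2 Ω → Prop} {ω : Set Ω} {w : Ω → ℝ} {α : ℝ}
  {S : ℕ → (ℝ → ℂ) → Ω → ℂ}

lemma IsPacketSynthesis.memLp (hS : IsPacketSynthesis A ω w α S) (hw : MemLp w 2 volume)
    (N : ℕ) {M D : ℝ} {F : ℝ → ℂ} (hF : HasFracExpansion α M D F) :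
    MemLp (S (N + 1) F) 2 volume := by
  obtain ⟨C, hC0, hC⟩ := hS.norm_le N M
  refine hw.of_le_mul (c := D * C) (hS.aestronglyMeasurable N M D F hF)
    (Eventually.of_forall fun x => (hC D F hF x).trans ?_)
  exact mul_le_mul_of_nonneg_left (le_abs_self _) (mul_nonneg hF.1 hC0)

/-- The symbol `exp (-(T - s) conj z r ^ α)` solves the adjoint equation frequency by frequency. Its
Taylor remainder in `s` is again in the class of expansions, so its synthesis is dominated by the
weight. -/
lemma IsPacketSynthesis.exists_isAdjointFamily (hS : IsPacketSynthesis A ω w α S)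
    (hw : MemLp w 2 volume) (hw0 : ∀ x, 0 ≤ w x) (z : ℂ) (T : ℝ) (N : ℕ) :
    ∃ φ ψ L, IsAdjointFamily A z T w
      (fun s => S (N + 1) (fracExp α (-((T - s : ℝ) : ℂ) * conj z)))
      (fun s => S (N + 1) (rpowMulFracExp α (-((T - s : ℝ) : ℂ) * conj z))) φ ψ L := by
  set a : ℝ → ℂ := fun s => -((T - s : ℝ) : ℂ) * conj z with ha
  -- The family is defined for all real `s`, so its membership in L² uses a bound depending on `s`;
  -- uniform bounds are needed only on `[0, T]`.
  have hE := fun s => hasFracExpansion_fracExp α (le_refl ‖a s‖)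
  have hE' := fun s => hasFracExpansion_rpowMulFracExp α (le_refl ‖a s‖)
  have haT : ∀ s ∈ Icc 0 T, ‖a s‖ ≤ T * ‖z‖ := fun s hs => by
    simp only [ha]
    rw [norm_mul, norm_neg, Complex.norm_real, RCLike.norm_conj, Real.norm_eq_abs,
      abs_of_nonneg (sub_nonneg.2 hs.2)]
    gcongr
    linarith [hs.1]
  -- The parameter `T * ‖z‖ + 2` is the largest of those of the symbol, its product with `r ^ α` and
  -- the remainder. The factor `3 + ‖z‖ ^ 2` below covers their amplitudes `1`, `3` and `‖z‖ ^ 2 (t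
  -- - s) ^ 2`.
  obtain ⟨C, hC0, hC⟩ := hS.norm_le N (T * ‖z‖ + 2)
  refine ⟨fun s => (hS.memLp hw N (hE s)).toLp _, fun s => (hS.memLp hw N (hE' s)).toLp _,
    (3 + ‖z‖ ^ 2) * C, ⟨?_, fun s => MemLp.coeFn_toLp _, fun s => MemLp.coeFn_toLp _, fun s => ?_,
    by positivity, fun s hs x => ?_, fun s hs x => ?_, fun s hs t ht x => ?_⟩⟩
  · exact hS.stronglyMeasurable N a (by fun_prop)
  · exact hS.graph N (a s) _ _ (MemLp.coeFn_toLp _) (MemLp.coeFn_toLp _)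
  · exact hC _ _ ((hasFracExpansion_fracExp α (haT s hs)).mono (by linarith)
      (by nlinarith [norm_nonneg z])) x
  · exact hC _ _ ((hasFracExpansion_rpowMulFracExp α (haT s hs)).mono (by linarith)
      (by nlinarith [norm_nonneg z])) x
  · have hd : a t - a s = ((t - s : ℝ) : ℂ) * conj z := by
      simp only [ha]
      push_cast
      ring
    have h1 := hC _ _ ((hasFracExpansion_remainder α (haT s hs) (haT t ht)).mono
      (by linarith : T * ‖z‖ + 1 ≤ T * ‖z‖ + 2) le_rfl) x
    rw [hS.linear N _ _ _ _ ⟨_, _, hE t⟩ ⟨_, _, hE s⟩ ⟨_, _, hE' s⟩, hd, mul_assoc] at h1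
    refine h1.trans ?_
    rw [norm_mul, Complex.norm_real, RCLike.norm_conj, Real.norm_eq_abs, mul_pow, sq_abs]
    have := hw0 x
    have h2 : 0 ≤ (t - s) ^ 2 * C * w x := by positivity
    nlinarith

/-- Null-controllability fails if packets can be synthesized that are small on `ω`. -/
theorem IsPacketSynthesis.not_nullControllable [SFinite (volume : Measure Ω)]
    (hS : IsPacketSynthesis A ω w α S) (hα0 : 0 ≤ α) (hα1 : α < 1) (hω : MeasurableSet ω)
    (hw : MemLp w 2 volume) (hw0 : ∀ x, 0 ≤ w x) {z : ℂ} (hz : 0 < z.re) {T : ℝ} (hT : 0 < T) :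
    ¬ NullControllable A z ω T := by
  intro hc
  choose φ ψ L H using hS.exists_isAdjointFamily hw hw0 z T
  obtain ⟨β, hβ, hloc⟩ := hS.norm_le_of_mem
  obtain ⟨C, hC0, hC⟩ := hloc (T * ‖z‖ + 1)
  obtain ⟨c, hc0, hlow⟩ := hS.le_norm
  obtain ⟨B, hB⟩ := hc.exists_norm_le hT.le hω hw hw0 H
    (K := fun N => C * ((N + 1).factorial / β ^ (N + 1 + 1)))
    (fun N => by positivity) (fun N s hs x hx => by
      refine hC N _ (hasFracExpansion_fracExp α ?_) x hx
      rw [norm_mul, norm_neg, Complex.norm_real, RCLike.norm_conj, Real.norm_eq_abs,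
        abs_of_nonneg (sub_nonneg.2 hs.2)]
      gcongr
      linarith [hs.1])
  refine not_forall_packetMass_le hα0 hα1 (T * z.re) (c⁻¹ * (B * C)) hβ fun N => ?_
  have hre : (-((T - 0 : ℝ) : ℂ) * conj z).re = -(T * z.re) := by simp
  have h1 := hlow N (-((T - 0 : ℝ) : ℂ) * conj z) (φ N 0)
    (by rw [hre]; have := mul_pos hT hz; linarith) ((H N).coe_ae_eq 0)
  rw [hre, neg_neg] at h1
  have h2 := h1.trans (hB N)
  rw [mul_assoc, le_inv_mul_iff₀ hc0, mul_assoc]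
  exact h2

end Synthesis

/-! ### Fourier transform of packets on the line. -/

noncomputable section RealLine

open Filter Topology ComplexConjugate SchwartzMap

/-- The L² transform and the integral transform are compared as tempered distributions: `L²` embeds
injectively, and Fubini moves the inverse transform from the test function to the integrable `P`. -/
lemma L2.fourier_eq_toLp_of_ae_eq_fourierInv {P : ℝ → ℂ} (hP1 : Integrable P)
    (hP2 : MemLp P 2 volume) {φ : L2 ℝ} (hφ : (φ : ℝ → ℂ) =ᵐ[volume] 𝓕⁻ P) :
    (𝓕 φ : L2 ℝ) = hP2.toLp P := by
  suffices h : (𝓕⁻ (hP2.toLp P) : L2 ℝ) = φ by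
    rw [← h]
    exact FourierTransform.fourier_fourierInv_eq _
  have hinj := LinearMap.ker_eq_bot.1
    (Lp.ker_toTemperedDistributionCLM_eq_bot (E := ℝ) (F := ℂ) (μ := volume) (p := 2))
  refine hinj ?_
  change Lp.toTemperedDistribution (𝓕⁻ (hP2.toLp P) : L2 ℝ) = Lp.toTemperedDistribution φ
  rw [← Lp.fourierInv_toTemperedDistribution_eq]
  ext ψ
  rw [TemperedDistribution.fourierInv_apply, Lp.toTemperedDistribution_apply,
    Lp.toTemperedDistribution_apply]
  have h1 : ∫ x, (𝓕⁻ ψ : 𝓢(ℝ, ℂ)) x • (hP2.toLp P) x = ∫ x, (𝓕⁻ ψ : 𝓢(ℝ, ℂ)) x • P x := by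
    refine integral_congr_ae ?_
    filter_upwards [hP2.coeFn_toLp] with x hx
    rw [hx]
  have h2 : ∫ x, ψ x • φ x = ∫ x, ψ x • 𝓕⁻ P x := by
    refine integral_congr_ae ?_
    filter_upwards [hφ] with x hx
    rw [hx]
  rw [h1, h2]
  have h3 := VectorFourier.integral_fourierIntegral_smul_eq_flip (L := -innerₗ ℝ)
    (μ := volume) (ν := volume) Real.continuous_fourierChar
    (by
      simp only [LinearMap.neg_apply, innerₗ_apply_apply]
      fun_prop) ψ.integrable hP1
  have h4 : (-innerₗ ℝ).flip = -innerₗ ℝ := by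
    ext
    simp
  rw [h4] at h3
  simpa [fourierInv_coe] using! h3


/-- The frequency profile `r ^ N exp (-r) F(r)`, `r > 0`. -/
def profile (N : ℕ) (F : ℝ → ℂ) : ℝ → ℂ :=
  (Ioi (0 : ℝ)).indicator fun r => (r : ℂ) ^ N * Complex.exp (-r) * F r

lemma profile_of_pos (N : ℕ) (F : ℝ → ℂ) {r : ℝ} (hr : 0 < r) :
    profile N F r = (r : ℂ) ^ N * Complex.exp (-r) * F r :=
  indicator_of_mem (show r ∈ Ioi 0 from hr) _

lemma profile_of_nonpos (N : ℕ) (F : ℝ → ℂ) {r : ℝ} (hr : r ≤ 0) : profile N F r = 0 :=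
  indicator_of_notMem (by simpa using hr) _

lemma profile_rpowMulFracExp (N : ℕ) (α : ℝ) (a : ℂ) (r : ℝ) :
    profile N (rpowMulFracExp α a) r = ((|r| ^ α : ℝ) : ℂ) * profile N (fracExp α a) r := by
  rcases le_or_gt r 0 with hr | hr
  · rw [profile_of_nonpos _ _ hr, profile_of_nonpos _ _ hr, mul_zero]
  · rw [profile_of_pos _ _ hr, profile_of_pos _ _ hr, abs_of_pos hr, rpowMulFracExp]
    ring

lemma profile_sub_sub (N : ℕ) (F G H : ℝ → ℂ) (c : ℂ) (r : ℝ) :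
    profile N (fun r => F r - G r - c * H r) r
      = profile N F r - profile N G r - c * profile N H r := by
  rcases le_or_gt r 0 with hr | hr
  · simp [profile_of_nonpos _ _ hr]
  · simp only [profile_of_pos _ _ hr]
    ring

lemma packet_eq_integral_profile (N : ℕ) (F : ℝ → ℂ) (y : ℝ) :
    packet N F y = ∫ r : ℝ, profile N F r * Complex.exp (Complex.I * y * r) := by
  rw [packet, ← integral_indicator measurableSet_Ioi]
  refine integral_congr_ae (Eventually.of_forall fun r => ?_)
  simp only
  rcases le_or_gt r 0 with hr | hr
  · rw [profile_of_nonpos _ _ hr, indicator_of_notMem (by simpa using hr), zero_mul]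
  · rw [profile_of_pos _ _ hr, indicator_of_mem (show r ∈ Ioi 0 from hr),
      show -((1 - (y : ℂ) * Complex.I) * r) = -r + Complex.I * y * r by ring, Complex.exp_add]
    ring

lemma measurable_profile (N : ℕ) {F : ℝ → ℂ} (hF : Measurable F) : Measurable (profile N F) :=
  Measurable.indicator (by fun_prop) measurableSet_Ioi

lemma HasFracExpansion.integrable_profile {α M D : ℝ} (hα0 : 0 ≤ α) (hα1 : α < 1) {F : ℝ → ℂ}
    (hF : HasFracExpansion α M D F) (N : ℕ) : Integrable (profile N F) := by
  have := hF.integrableOn hα0 hα1 N 0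
  rw [profile, integrable_indicator_iff measurableSet_Ioi]
  simpa using this

lemma HasFracExpansion.norm_profile_le {α M D : ℝ} {F : ℝ → ℂ} (hF : HasFracExpansion α M D F)
    (N : ℕ) {r : ℝ} (hr : 0 < r) :
    ‖profile N F r‖ ≤ D * (r ^ N * Real.exp (-(1 * r)) * Real.exp (M * r ^ α)) := by
  have := hF.norm_integrand_le N 0 hr
  rw [profile_of_pos _ _ hr]
  simpa using this

lemma HasFracExpansion.integrable_norm_profile_sq {α M D : ℝ} (hα0 : 0 ≤ α) (hα1 : α < 1)
    {F : ℝ → ℂ} (hF : HasFracExpansion α M D F) (N : ℕ) :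
    Integrable (fun r => ‖profile N F r‖ ^ 2) := by
  have h1 := (integrableOn_pow_mul_exp_mul_exp_rpow hα0 hα1 (2 * N) (2 * M)
    two_pos).integrable_indicator measurableSet_Ioi
  refine (h1.const_mul (D ^ 2)).mono'
    ((measurable_profile N hF.2.2.1).norm.pow_const 2).aestronglyMeasurable
    (Eventually.of_forall fun r => ?_)
  rcases le_or_gt r 0 with hr | hr
  · rw [profile_of_nonpos _ _ hr, indicator_of_notMem (by simpa using hr)]
    simp
  · rw [indicator_of_mem (show r ∈ Ioi 0 from hr), norm_pow, norm_norm]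
    refine (pow_le_pow_left₀ (norm_nonneg _) (hF.norm_profile_le N hr) 2).trans_eq ?_
    rw [mul_pow, mul_pow, mul_pow, ← pow_mul, ← Real.exp_nat_mul, ← Real.exp_nat_mul, mul_comm N]
    push_cast
    ring_nf

lemma packetMass_le_norm_profile {α : ℝ} (hα0 : 0 ≤ α) {a : ℂ} (ha : a.re ≤ 0) (N : ℕ) {r : ℝ}
    (hr0 : 0 < r) (hr1 : N ≤ r) (hr2 : r ≤ N + 1) :
    packetMass α (-a.re) N ≤ ‖profile N (fracExp α a) r‖ := by
  rw [profile_of_pos _ _ hr0, packetMass, fracExp, norm_mul, norm_mul, Complex.norm_exp,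
    Complex.norm_exp, norm_pow, Complex.norm_real, Real.norm_eq_abs, abs_of_pos hr0]
  have e : (a * ((r ^ α : ℝ) : ℂ)).re = -(-a.re * r ^ α) := by simp
  rw [e]
  have h1 : r ^ α ≤ ((N : ℝ) + 1) ^ α := by gcongr
  have h2 : -((N : ℝ) + 1) ≤ (-(r : ℂ)).re := by simpa using by linarith
  have h3 : 0 ≤ -a.re := by linarith
  gcongr

/-- The Fourier transform of `x ↦ packet N F (x - x₀)`. -/
def packetFourier (x₀ : ℝ) (N : ℕ) (F : ℝ → ℂ) (ξ : ℝ) : ℂ :=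
  2 * Real.pi * profile N F (2 * Real.pi * ξ) * Complex.exp (-(2 * Real.pi * ξ * x₀ * Complex.I))

lemma norm_packetFourier (x₀ : ℝ) (N : ℕ) (F : ℝ → ℂ) (ξ : ℝ) :
    ‖packetFourier x₀ N F ξ‖ = 2 * Real.pi * ‖profile N F (2 * Real.pi * ξ)‖ := by
  rw [packetFourier, norm_mul, Complex.norm_exp, norm_mul]
  simp [abs_of_pos Real.pi_pos]

lemma measurable_packetFourier (x₀ : ℝ) (N : ℕ) {F : ℝ → ℂ} (hF : Measurable F) :
    Measurable (packetFourier x₀ N F) := by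
  have := measurable_profile N hF
  unfold packetFourier
  fun_prop

lemma HasFracExpansion.integrable_packetFourier {α M D : ℝ} (hα0 : 0 ≤ α) (hα1 : α < 1)
    {F : ℝ → ℂ} (hF : HasFracExpansion α M D F) (x₀ : ℝ) (N : ℕ) :
    Integrable (packetFourier x₀ N F) := by
  refine (integrable_norm_iff (measurable_packetFourier x₀ N hF.2.2.1).aestronglyMeasurable).1 ?_
  simp_rw [norm_packetFourier]
  exact ((hF.integrable_profile hα0 hα1 N).norm.comp_mul_left'
    (R := 2 * Real.pi) Real.two_pi_pos.ne').const_mul _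

lemma HasFracExpansion.memLp_packetFourier {α M D : ℝ} (hα0 : 0 ≤ α) (hα1 : α < 1)
    {F : ℝ → ℂ} (hF : HasFracExpansion α M D F) (x₀ : ℝ) (N : ℕ) :
    MemLp (packetFourier x₀ N F) 2 volume := by
  refine (memLp_two_iff_integrable_sq_norm
    (measurable_packetFourier x₀ N hF.2.2.1).aestronglyMeasurable).2 ?_
  simp_rw [norm_packetFourier, mul_pow _ ‖_‖]
  exact ((hF.integrable_norm_profile_sq hα0 hα1 N).comp_mul_left'
    (R := 2 * Real.pi) Real.two_pi_pos.ne').const_mul _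

lemma fourierInv_packetFourier (x₀ : ℝ) (N : ℕ) (F : ℝ → ℂ) (x : ℝ) :
    𝓕⁻ (packetFourier x₀ N F) x = packet N F (x - x₀) := by
  rw [Real.fourierInv_eq', packet_eq_integral_profile]
  have h1 := Measure.integral_comp_mul_left
    (fun r : ℝ => profile N F r * Complex.exp (Complex.I * ((x - x₀ : ℝ) : ℂ) * r)) (2 * Real.pi)
  rw [abs_of_pos (inv_pos.2 Real.two_pi_pos), eq_inv_smul_iff₀ Real.two_pi_pos.ne'] at h1
  rw [← h1, ← integral_smul]
  refine integral_congr_ae (Eventually.of_forall fun ξ => ?_)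
  simp only [packetFourier, smul_eq_mul, Complex.real_smul]
  have e : Complex.exp (Complex.I * ((x - x₀ : ℝ) : ℂ) * ((2 * Real.pi * ξ : ℝ) : ℂ))
      = Complex.exp (((2 * Real.pi * inner ℝ ξ x : ℝ) : ℂ) * Complex.I)
        * Complex.exp (-(2 * Real.pi * ξ * x₀ * Complex.I)) := by
    rw [← Complex.exp_add]
    congr 1
    simp
    ring
  rw [e]
  push_cast
  ring

lemma HasFracExpansion.fourier_eq {α M D : ℝ} (hα0 : 0 ≤ α) (hα1 : α < 1)
    {F : ℝ → ℂ} (hF : HasFracExpansion α M D F) (x₀ : ℝ) (N : ℕ) {φ : L2 ℝ}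
    (hφ : (φ : ℝ → ℂ) =ᵐ[volume] fun x => packet N F (x - x₀)) :
    ((𝓕 φ : L2 ℝ) : ℝ → ℂ) =ᵐ[volume] packetFourier x₀ N F := by
  have h1 : (φ : ℝ → ℂ) =ᵐ[volume] 𝓕⁻ (packetFourier x₀ N F) := by
    filter_upwards [hφ] with x hx
    rw [hx, fourierInv_packetFourier]
  rw [L2.fourier_eq_toLp_of_ae_eq_fourierInv (hF.integrable_packetFourier hα0 hα1 x₀ N)
    (hF.memLp_packetFourier hα0 hα1 x₀ N) h1]
  exact MemLp.coeFn_toLp _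

end RealLine

/-! ### Packets on the line satisfy the abstract requirements. -/

noncomputable section RealLineSynthesis

open Filter Topology ComplexConjugate

lemma packet_sub_sub {α : ℝ} (hα0 : 0 ≤ α) (hα1 : α < 1) (N : ℕ) {F G H : ℝ → ℂ} (c : ℂ)
    (hF : ∃ M D, HasFracExpansion α M D F) (hG : ∃ M D, HasFracExpansion α M D G)
    (hH : ∃ M D, HasFracExpansion α M D H) (y : ℝ) :
    packet N (fun r => F r - G r - c * H r) y
      = packet N F y - packet N G y - c * packet N H y := by
  obtain ⟨_, _, hF⟩ := hF
  obtain ⟨_, _, hG⟩ := hG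
  obtain ⟨_, _, hH⟩ := hH
  have iF := hF.integrableOn hα0 hα1 N y
  have iG := hG.integrableOn hα0 hα1 N y
  have iH := hH.integrableOn hα0 hα1 N y
  rw [packet, packet, packet, packet, ← integral_const_mul, ← integral_sub iF iG]
  refine Eq.trans ?_ (integral_sub (iF.sub iG) (iH.const_mul c))
  refine integral_congr_ae (Eventually.of_forall fun r => ?_)
  simp only
  ring

lemma stronglyMeasurable_packet (N : ℕ) {F : ℝ → ℂ} (hF : Measurable F) :
    StronglyMeasurable (packet N F) := by
  refine StronglyMeasurable.integral_prod_right' (ν := volume.restrict (Ioi (0 : ℝ)))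
    (f := fun q : ℝ × ℝ => (q.2 : ℂ) ^ N * Complex.exp (-((1 - q.1 * Complex.I) * q.2)) * F q.2) ?_
  exact Measurable.stronglyMeasurable (by fun_prop)

lemma stronglyMeasurable_packet_fracExp (α x₀ : ℝ) (N : ℕ) {a : ℝ → ℂ} (ha : Continuous a) :
    StronglyMeasurable (Function.uncurry fun s x => packet N (fracExp α (a s)) (x - x₀)) := by
  have := ha.measurable
  refine StronglyMeasurable.integral_prod_right' (ν := volume.restrict (Ioi (0 : ℝ)))
    (f := fun q : (ℝ × ℝ) × ℝ => (q.2 : ℂ) ^ N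
      * Complex.exp (-((1 - ((q.1.2 - x₀ : ℝ) : ℂ) * Complex.I) * q.2))
      * fracExp α (a q.1.1) q.2) ?_
  unfold fracExp
  exact Measurable.stronglyMeasurable (by fun_prop)

lemma one_le_sqrt_one_add_sq (y : ℝ) : 1 ≤ √(1 + y ^ 2) :=
  Real.one_le_sqrt.2 (by nlinarith [sq_nonneg y])

/-- Since `√(1 + y²) ≥ 1` everywhere, the decay estimate with `b = 1` and `β = 1/2` holds for all
`y`; the constant may depend on `N`. -/
lemma exists_norm_packet_le_global {α : ℝ} (hα0 : 0 ≤ α) (hα1 : α < 1) (N : ℕ) (M : ℝ) :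
    ∃ C, 0 ≤ C ∧ ∀ D F, HasFracExpansion α M D F → ∀ y,
      ‖packet (N + 1) F y‖ ≤ D * C * (1 + y ^ 2)⁻¹ := by
  obtain ⟨C, hC0, hC⟩ := exists_norm_packet_le hα0 hα1 M (one_half_pos (α := ℝ)) one_half_lt_one
  exact ⟨C * (N + 1).factorial / (1 / 2) ^ (N + 1 + 1), by positivity, fun D F hF y =>
    hC D F hF (N + 1) (by omega) y (one_le_sqrt_one_add_sq y)⟩

/-- Away from the centre `√(1 + y²) ≥ √(1 + δ²) > 1`, which leaves room for `β > 1`: this is the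
exponential gain in `N`. -/
lemma exists_norm_packet_le_of_le_abs {α : ℝ} (hα0 : 0 ≤ α) (hα1 : α < 1) {δ : ℝ} (hδ : 0 < δ) :
    ∃ β, 1 < β ∧ ∀ M, ∃ C, 0 < C ∧ ∀ N F, HasFracExpansion α M 1 F → ∀ y, δ ≤ |y| →
      ‖packet (N + 1) F y‖ ≤ C * ((N + 1).factorial / β ^ (N + 1 + 1)) * (1 + y ^ 2)⁻¹ := by
  have hb : 1 < √(1 + δ ^ 2) := by
    rw [Real.lt_sqrt zero_le_one]
    nlinarith
  obtain ⟨β, hβ1, hβ2⟩ := exists_between hb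
  refine ⟨β, hβ1, fun M => ?_⟩
  obtain ⟨C, hC0, hC⟩ := exists_norm_packet_le hα0 hα1 M (zero_lt_one.trans hβ1) hβ2
  refine ⟨C, hC0, fun N F hF y hy => ?_⟩
  have h1 : √(1 + δ ^ 2) ≤ √(1 + y ^ 2) := by
    refine Real.sqrt_le_sqrt (add_le_add le_rfl ?_)
    rw [← sq_abs y]
    gcongr
  have := hC 1 F hF (N + 1) (by omega) y h1
  rwa [one_mul, mul_div_assoc] at this

lemma memLp_inv_one_add_sub_sq (x₀ : ℝ) :
    MemLp (fun x : ℝ => (1 + (x - x₀) ^ 2)⁻¹) 2 volume := by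
  have hm : Measurable fun x : ℝ => (1 + (x - x₀) ^ 2)⁻¹ := by fun_prop
  refine (memLp_two_iff_integrable_sq_norm hm.aestronglyMeasurable).2 ?_
  refine (integrable_inv_one_add_sq.comp_sub_right x₀).mono'
    (hm.norm.pow_const 2).aestronglyMeasurable (Eventually.of_forall fun x => ?_)
  have h1 : 0 < 1 + (x - x₀) ^ 2 := by positivity
  have h2 : (1 + (x - x₀) ^ 2)⁻¹ ≤ 1 := inv_le_one_of_one_le₀ (by nlinarith [sq_nonneg (x - x₀)])
  rw [norm_pow, norm_norm, Real.norm_eq_abs, abs_of_pos (inv_pos.2 h1), sq]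
  exact mul_le_of_le_one_left (inv_pos.2 h1).le h2

lemma isFracLaplacianReal_of_packet {α : ℝ} (hα0 : 0 ≤ α) (hα1 : α < 1) (x₀ : ℝ) (N : ℕ) (a : ℂ)
    {φ ψ : L2 ℝ} (hφ : (φ : ℝ → ℂ) =ᵐ[volume] fun x => packet N (fracExp α a) (x - x₀))
    (hψ : (ψ : ℝ → ℂ) =ᵐ[volume] fun x => packet N (rpowMulFracExp α a) (x - x₀)) :
    IsFracLaplacianReal α φ ψ := by
  have h1 := (hasFracExpansion_fracExp α (le_refl ‖a‖)).fourier_eq hα0 hα1 x₀ N hφ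
  have h2 := (hasFracExpansion_rpowMulFracExp α (le_refl ‖a‖)).fourier_eq hα0 hα1 x₀ N hψ
  rw [IsFracLaplacianReal]
  filter_upwards [h1, h2] with ξ h3 h4
  rw [h3, h4, packetFourier, packetFourier, profile_rpowMulFracExp]
  ring

/-- By Plancherel it suffices to integrate over the frequencies `2πξ ∈ [N + 1, N + 2]`, where the
profile is at least the packet mass. -/
lemma mul_packetMass_le_norm {α : ℝ} (hα0 : 0 ≤ α) (hα1 : α < 1) (x₀ : ℝ) (N : ℕ) {a : ℂ}
    (ha : a.re ≤ 0) {φ : L2 ℝ}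
    (hφ : (φ : ℝ → ℂ) =ᵐ[volume] fun x => packet (N + 1) (fracExp α a) (x - x₀)) :
    2 * Real.pi * ((2 * Real.pi)⁻¹) ^ (1 / 2 : ℝ) * packetMass α (-a.re) (N + 1) ≤ ‖φ‖ := by
  have h1 := (hasFracExpansion_fracExp α (le_refl ‖a‖)).fourier_eq hα0 hα1 x₀ (N + 1) hφ
  have hpi := Real.two_pi_pos
  set I : Set ℝ := Icc ((N + 1) / (2 * Real.pi)) ((N + 1 + 1) / (2 * Real.pi)) with hI
  have hIv : volume I = ENNReal.ofReal ((2 * Real.pi)⁻¹) := by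
    rw [hI, Real.volume_Icc]
    congr 1
    field_simp
    ring
  have hmass : 0 ≤ packetMass α (-a.re) (N + 1) := by
    unfold packetMass
    positivity
  have h2 : ‖indicatorConstLp 2 (measurableSet_Icc : MeasurableSet I) (by rw [hIv]; simp)
      (2 * Real.pi * packetMass α (-a.re) (N + 1) : ℝ)‖ ≤ ‖(𝓕 φ : L2 ℝ)‖ := by
    refine Lp.norm_le_norm_of_ae_le ?_
    filter_upwards [h1, indicatorConstLp_coeFn (p := 2) (μ := volume)
      (hs := (measurableSet_Icc : MeasurableSet I)) (hμs := by rw [hIv]; simp)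
      (c := (2 * Real.pi * packetMass α (-a.re) (N + 1) : ℝ))] with ξ h3 h4
    rw [h3, h4]
    by_cases hξ : ξ ∈ I
    · rw [indicator_of_mem hξ, norm_packetFourier, Real.norm_eq_abs, abs_of_nonneg (by positivity)]
      rw [hI, mem_Icc, div_le_iff₀' hpi, le_div_iff₀' hpi] at hξ
      refine mul_le_mul_of_nonneg_left ?_ hpi.le
      refine packetMass_le_norm_profile hα0 ha (N + 1) ?_ ?_ ?_
      · have : (0 : ℝ) < (N : ℝ) + 1 := by positivity
        linarith [hξ.1]
      · push_cast
        exact hξ.1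
      · push_cast
        exact hξ.2
    · rw [indicator_of_notMem hξ, norm_zero]
      exact norm_nonneg _
  rw [Lp.norm_fourier_eq, norm_indicatorConstLp (by simp) (by simp), Measure.real, hIv,
    ENNReal.toReal_ofReal (by positivity), Real.norm_eq_abs, abs_of_nonneg (by positivity)] at h2
  refine le_of_eq_of_le ?_ h2
  simp only [ENNReal.toReal_ofNat]
  ring

lemma isPacketSynthesis_real {α : ℝ} (hα0 : 0 ≤ α) (hα1 : α < 1) {ω : Set ℝ} {x₀ δ : ℝ}
    (hδ : 0 < δ) (hω : ∀ x ∈ ω, δ ≤ |x - x₀|) :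
    IsPacketSynthesis (IsFracLaplacianReal α) ω (fun x => (1 + (x - x₀) ^ 2)⁻¹) α
      (fun N F x => packet N F (x - x₀)) where
  aestronglyMeasurable N M D F hF :=
    ((stronglyMeasurable_packet (N + 1) hF.2.2.1).comp_measurable
      (measurable_id.sub_const x₀)).aestronglyMeasurable
  linear N F G H c hF hG hH x := packet_sub_sub hα0 hα1 (N + 1) c hF hG hH _
  stronglyMeasurable N a ha := stronglyMeasurable_packet_fracExp α x₀ (N + 1) ha
  norm_le N M := by
    obtain ⟨C, hC0, hC⟩ := exists_norm_packet_le_global hα0 hα1 N M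
    exact ⟨C, hC0, fun D F hF x => hC D F hF _⟩
  norm_le_of_mem := by
    obtain ⟨β, hβ, H⟩ := exists_norm_packet_le_of_le_abs hα0 hα1 hδ
    refine ⟨β, hβ, fun M => ?_⟩
    obtain ⟨C, hC0, hC⟩ := H M
    exact ⟨C, hC0, fun N F hF x hx => hC N F hF _ (hω x hx)⟩
  graph N a φ ψ hφ hψ := isFracLaplacianReal_of_packet hα0 hα1 x₀ (N + 1) a hφ hψ
  le_norm := ⟨2 * Real.pi * ((2 * Real.pi)⁻¹) ^ (1 / 2 : ℝ), by positivity,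
    fun N a φ ha hφ => mul_packetMass_le_norm hα0 hα1 x₀ N ha hφ⟩

theorem not_nullControllable_real {α : ℝ} (hα0 : 0 ≤ α) (hα1 : α < 1) {z : ℂ} (hz : 0 < z.re)
    {ω : Set ℝ} (hω : IsOpen ω) (hωc : (interior ωᶜ).Nonempty) {T : ℝ} (hT : 0 < T) :
    ¬ NullControllable (IsFracLaplacianReal α) z ω T := by
  obtain ⟨x₀, hx₀⟩ := hωc
  obtain ⟨δ, hδ, hball⟩ := Metric.isOpen_iff.1 isOpen_interior x₀ hx₀
  refine (isPacketSynthesis_real hα0 hα1 hδ fun x hx => ?_).not_nullControllable hα0 hα1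
    hω.measurableSet (memLp_inv_one_add_sub_sq x₀) (fun x => by positivity) hz hT
  by_contra hlt
  exact interior_subset (hball (by rwa [Metric.mem_ball, Real.dist_eq, ← not_le])) hx

end RealLineSynthesis

/-! ### Periodized packets on the torus, by Poisson summation. -/

noncomputable section TorusSynthesis

open Filter Topology ComplexConjugate

lemma HasFracExpansion.continuousOn {α M D : ℝ} (hα0 : 0 ≤ α) {F : ℝ → ℂ}
    (hF : HasFracExpansion α M D F) : ContinuousOn F (Ioi 0) := by
  obtain ⟨hD, hM, -, c, hc, hs⟩ := hF
  intro r hr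
  have hr' : (0 : ℝ) < r := hr
  refine ContinuousAt.continuousWithinAt ?_
  have h1 : ContinuousOn (fun r : ℝ => ∑' k, c k * (((r ^ α) ^ k : ℝ) : ℂ)) (Ioo 0 (r + 1)) := by
    refine continuousOn_tsum (fun k => ?_) (hasSum_pow_div_factorial D M ((r + 1) ^ α)).summable
      fun k ρ hρ => ?_
    · have : ContinuousOn (fun r : ℝ => r ^ α) (Ioo 0 (r + 1)) := fun ρ hρ =>
        (Real.continuousAt_rpow_const ρ α (Or.inl hρ.1.ne')).continuousWithinAt
      exact continuousOn_const.mul (Complex.continuous_ofReal.comp_continuousOn (this.pow k))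
    · have hρ0 := hρ.1.le
      rw [norm_mul, Complex.norm_real, Real.norm_eq_abs, abs_of_nonneg (by positivity)]
      have h2 : ρ ^ α ≤ (r + 1) ^ α := by
        gcongr
        exact hρ.2.le
      gcongr
      exact hc k
  have hmem : Ioo 0 (r + 1) ∈ 𝓝 r := Ioo_mem_nhds hr' (by linarith)
  refine (h1.continuousAt hmem).congr ?_
  filter_upwards [hmem] with ρ hρ
  exact (hs ρ hρ.1).tsum_eq

/-- Poisson summation requires a continuous profile. The factor `r ^ (N + 1)`, with exponent at
least one, removes the jump at `0`, near which `F` stays bounded. -/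
lemma HasFracExpansion.continuous_profile {α M D : ℝ} (hα0 : 0 ≤ α) {F : ℝ → ℂ}
    (hF : HasFracExpansion α M D F) (N : ℕ) : Continuous (profile (N + 1) F) := by
  rw [continuous_iff_continuousAt]
  intro r
  rcases lt_trichotomy r 0 with hr | rfl | hr
  · refine continuousAt_const (y := (0 : ℂ)) |>.congr ?_
    filter_upwards [Iio_mem_nhds hr] with ρ hρ
    exact (profile_of_nonpos _ _ (le_of_lt hρ)).symm
  · rw [ContinuousAt, profile_of_nonpos _ _ le_rfl]
    refine squeeze_zero_norm' (a := fun ρ : ℝ => D * Real.exp M * |ρ|) ?_ ?_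
    · filter_upwards [Iio_mem_nhds (zero_lt_one' ℝ)] with ρ hρ1
      have hD := hF.1
      have hM := hF.2.1
      rcases le_or_gt ρ 0 with hρ | hρ
      · rw [profile_of_nonpos _ _ hρ, norm_zero]
        positivity
      · refine (hF.norm_profile_le (N + 1) hρ).trans ?_
        rw [abs_of_pos hρ]
        have hρ1' : ρ ≤ 1 := le_of_lt hρ1
        have h1 : ρ ^ (N + 1) ≤ ρ := by
          rw [pow_succ]
          exact mul_le_of_le_one_left hρ.le (pow_le_one₀ hρ.le hρ1')
        have h2 : Real.exp (-(1 * ρ)) ≤ 1 := Real.exp_le_one_iff.2 (by linarith)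
        have h3 : Real.exp (M * ρ ^ α) ≤ Real.exp M :=
          Real.exp_le_exp.2 (mul_le_of_le_one_right hM (Real.rpow_le_one hρ.le hρ1' hα0))
        calc _ ≤ D * (ρ * 1 * Real.exp M) := by gcongr
          _ = _ := by ring
    · have : Continuous fun ρ : ℝ => D * Real.exp M * |ρ| := by fun_prop
      simpa using this.tendsto 0
  · have h1 : ContinuousOn (fun r : ℝ => (r : ℂ) ^ (N + 1) * Complex.exp (-r) * F r) (Ioi 0) :=
      ContinuousOn.mul (by fun_prop) (hF.continuousOn hα0)
    refine (h1.continuousAt (Ioi_mem_nhds hr)).congr ?_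
    filter_upwards [Ioi_mem_nhds hr] with ρ hρ
    exact (profile_of_pos _ _ hρ).symm

lemma HasFracExpansion.exists_norm_profile_le {α M D : ℝ} (hα0 : 0 ≤ α) (hα1 : α < 1) {F : ℝ → ℂ}
    (hF : HasFracExpansion α M D F) (N : ℕ) :
    ∃ C, 0 ≤ C ∧ ∀ r, ‖profile N F r‖ ≤ C * (1 + r ^ 2)⁻¹ := by
  obtain ⟨C, hC⟩ := exists_mul_rpow_le hα0 hα1 M (one_half_pos (α := ℝ))
  have hD := hF.1
  refine ⟨D * Real.exp C * (N.factorial * 2 ^ N + (N + 2).factorial * 2 ^ (N + 2)),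
    by positivity, fun r => ?_⟩
  rcases le_or_gt r 0 with hr | hr
  · rw [profile_of_nonpos _ _ hr, norm_zero]
    positivity
  refine (hF.norm_profile_le N hr).trans ?_
  rw [← div_eq_mul_inv, le_div_iff₀ (by positivity)]
  have hpow : ∀ k : ℕ, r ^ k * Real.exp (-(r / 2)) ≤ k.factorial * 2 ^ k := fun k => by
    have := Real.pow_div_factorial_le_exp (x := r / 2) (by positivity) k
    rw [div_pow, div_div, div_le_iff₀ (by positivity)] at this
    rw [Real.exp_neg, ← div_eq_mul_inv, div_le_iff₀ (Real.exp_pos _)]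
    linarith
  have hexp : Real.exp (-(1 * r)) * Real.exp (M * r ^ α)
      ≤ Real.exp C * Real.exp (-(r / 2)) := by
    rw [← Real.exp_add, ← Real.exp_add]
    refine Real.exp_le_exp.2 ?_
    linarith [hC r hr.le]
  calc D * (r ^ N * Real.exp (-(1 * r)) * Real.exp (M * r ^ α)) * (1 + r ^ 2)
      = D * (r ^ N * (1 + r ^ 2)) * (Real.exp (-(1 * r)) * Real.exp (M * r ^ α)) := by ring
    _ ≤ D * (r ^ N * (1 + r ^ 2)) * (Real.exp C * Real.exp (-(r / 2))) := by gcongr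
    _ = D * Real.exp C * (r ^ N * Real.exp (-(r / 2)) + r ^ (N + 2) * Real.exp (-(r / 2))) := by
        ring
    _ ≤ _ := mul_le_mul_of_nonneg_left (add_le_add (hpow N) (hpow (N + 2))) (by positivity)

lemma summable_inv_one_add_int_sq : Summable fun n : ℤ => (1 + (n : ℝ) ^ 2)⁻¹ := by
  have h : Summable fun n : ℕ => (1 + (n : ℝ) ^ 2)⁻¹ := by
    refine Summable.of_nonneg_of_le (fun n => by positivity) (fun n => ?_)
      ((Real.summable_nat_pow_inv.2 one_lt_two).add (summable_of_ne_finset_zero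
        (f := fun n : ℕ => if n = 0 then (1 : ℝ) else 0) (s := {0}) (by simp)))
    rcases eq_or_ne n 0 with rfl | hn
    · simp
    · rw [if_neg hn, add_zero]
      have : (0 : ℝ) < n := by exact_mod_cast Nat.pos_of_ne_zero hn
      gcongr
      linarith
  exact Summable.of_nat_of_neg (by simpa using h) (by simpa using h)

lemma HasFracExpansion.summable_norm_profile {α M D : ℝ} (hα0 : 0 ≤ α) (hα1 : α < 1) {F : ℝ → ℂ}
    (hF : HasFracExpansion α M D F) (N : ℕ) : Summable fun n : ℤ => ‖profile N F n‖ := by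
  obtain ⟨C, -, hC⟩ := hF.exists_norm_profile_le hα0 hα1 N
  exact Summable.of_nonneg_of_le (fun n => norm_nonneg _) (fun n => hC n)
    (summable_inv_one_add_int_sq.mul_left C)

/-- The function on the torus with the Fourier coefficients `profile N F n`. -/
def torusPacket (N : ℕ) (F : ℝ → ℂ) (x : Torus) : ℂ :=
  ∑' n : ℤ, profile N F n * fourier n x

lemma fourier_coe_torus (n : ℤ) (y : ℝ) :
    fourier n (y : Torus) = Complex.exp (Complex.I * y * n) := by
  rw [fourier_coe_apply]
  congr 1
  have : (Real.pi : ℂ) ≠ 0 := by exact_mod_cast Real.pi_ne_zero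
  push_cast
  field_simp

lemma fourier_profile_mul_exp (N : ℕ) (F : ℝ → ℂ) (y : ℝ) (k : ℤ) :
    𝓕 (fun r : ℝ => profile N F r * Complex.exp (Complex.I * y * r)) (k : ℝ)
      = packet N F (y - 2 * Real.pi * k) := by
  rw [Real.fourier_eq', packet_eq_integral_profile]
  refine integral_congr_ae (Eventually.of_forall fun r => ?_)
  simp only [smul_eq_mul]
  rw [mul_left_comm, ← Complex.exp_add]
  congr 2
  simp
  ring

/-- No translate of `y` by a period comes closer to the centre than `y` itself, so smallness away
from the centre survives periodization; the bound by `|k|` makes the sum over translates converge.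
-/
lemma abs_le_abs_sub_two_pi_mul {y : ℝ} (hy : |y| ≤ Real.pi) (k : ℤ) :
    |y| ≤ |y - 2 * Real.pi * k| ∧ |(k : ℝ)| ≤ |y - 2 * Real.pi * k| := by
  rcases eq_or_ne k 0 with rfl | hk
  · simp
  have h1 : (1 : ℝ) ≤ |(k : ℝ)| := by exact_mod_cast Int.one_le_abs hk
  have h2 : |2 * Real.pi * (k : ℝ)| - |y| ≤ |y - 2 * Real.pi * k| := by
    rw [abs_sub_comm]
    exact abs_sub_abs_le_abs_sub _ _
  rw [abs_mul, abs_of_pos Real.two_pi_pos] at h2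
  have h3 := Real.pi_gt_three
  constructor <;> nlinarith

/-- Poisson summation for packets. -/
lemma HasFracExpansion.norm_torusPacket_le {α M D : ℝ} (hα0 : 0 ≤ α) (hα1 : α < 1) {F : ℝ → ℂ}
    (hF : HasFracExpansion α M D F) (N : ℕ) {y : ℝ} (hy : |y| ≤ Real.pi) {B : ℝ} (hB0 : 0 ≤ B)
    (hB : ∀ y', |y| ≤ |y'| → ‖packet (N + 1) F y'‖ ≤ B * (1 + y' ^ 2)⁻¹) :
    ‖torusPacket (N + 1) F (y : Torus)‖ ≤ B * ∑' k : ℤ, (1 + (k : ℝ) ^ 2)⁻¹ := by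
  -- The character is included in `f`, so Poisson summation is applied at the point `0` and the
  -- transform of `f` at `k` is the packet at `y - 2πk`.
  set f : ℝ → ℂ := fun r => profile (N + 1) F r * Complex.exp (Complex.I * y * r) with hf
  have hbound : ∀ k : ℤ, ‖𝓕 f (k : ℝ)‖ ≤ B * (1 + (k : ℝ) ^ 2)⁻¹ := by
    intro k
    obtain ⟨h1, h2⟩ := abs_le_abs_sub_two_pi_mul hy k
    rw [hf, fourier_profile_mul_exp]
    refine (hB _ h1).trans ?_
    have := sq_le_sq.2 h2
    gcongr
  have hsum := summable_inv_one_add_int_sq.mul_left B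
  have hsum' : Summable fun k : ℤ => 𝓕 f (k : ℝ) := Summable.of_norm_bounded hsum hbound
  have hcont : Continuous f := (hF.continuous_profile hα0 N).mul (by fun_prop)
  have hdecay : f =O[cocompact ℝ] fun x : ℝ => |x| ^ (-2 : ℝ) := by
    obtain ⟨C, hC0, hC⟩ := hF.exists_norm_profile_le hα0 hα1 (N + 1)
    refine Asymptotics.IsBigO.of_bound C ?_
    have hne : ∀ᶠ x : ℝ in cocompact ℝ, x ≠ 0 :=
      (isCompact_singleton (x := (0 : ℝ))).compl_mem_cocompact
    filter_upwards [hne] with x hx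
    have e : ‖Complex.exp (Complex.I * y * x)‖ = 1 := by
      rw [Complex.norm_exp]
      simp
    rw [hf, norm_mul, e, mul_one, Real.rpow_neg (abs_nonneg x), Real.rpow_two, sq_abs,
      Real.norm_eq_abs, abs_of_nonneg (by positivity)]
    refine (hC x).trans ?_
    have : 0 < x ^ 2 := by positivity
    gcongr
    linarith
  have hpois := Real.tsum_eq_tsum_fourier_of_rpow_decay_of_summable hcont one_lt_two hdecay hsum' 0
  have e1 : torusPacket (N + 1) F (y : Torus) = ∑' n : ℤ, f (0 + n) := by
    refine tsum_congr fun n => ?_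
    rw [zero_add, fourier_coe_torus, hf]
    simp
  have e2 : ∑' n : ℤ, 𝓕 f n * fourier n (((0 : ℝ)) : UnitAddCircle) = ∑' n : ℤ, 𝓕 f n := by
    refine tsum_congr fun n => ?_
    rw [fourier_coe_apply]
    simp
  rw [e1, hpois, e2, ← tsum_mul_left]
  exact tsum_of_norm_bounded hsum.hasSum hbound

lemma exists_coe_eq_of_torus (x : Torus) : ∃ y : ℝ, (y : Torus) = x ∧ |y| = ‖x‖ := by
  obtain ⟨y, hy, rfl⟩ := (AddCircle.coe_image_Ico_eq (2 * Real.pi) (-Real.pi)).symm ▸ mem_univ x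
  refine ⟨y, rfl, ((AddCircle.norm_coe_eq_abs_iff _ Real.two_pi_pos.ne').2 ?_).symm⟩
  rw [abs_of_pos Real.two_pi_pos, abs_le]
  constructor <;> linarith [hy.1, hy.2]

lemma torus_norm_le_pi (x : Torus) : ‖x‖ ≤ Real.pi := by
  have := AddCircle.norm_le_half_period (2 * Real.pi) Real.two_pi_pos.ne' (x := x)
  rwa [abs_of_pos Real.two_pi_pos, mul_div_cancel_left₀ _ two_ne_zero] at this

lemma norm_fourier_torus (n : ℤ) (x : Torus) : ‖fourier n x‖ = 1 := by
  rw [fourier_apply]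
  exact Circle.norm_coe _

lemma HasFracExpansion.summable_torusPacket {α M D : ℝ} (hα0 : 0 ≤ α) (hα1 : α < 1)
    {F : ℝ → ℂ} (hF : HasFracExpansion α M D F) (N : ℕ) (x : Torus) :
    Summable fun n : ℤ => profile N F n * fourier n x := by
  refine Summable.of_norm ?_
  simp_rw [norm_mul, norm_fourier_torus, mul_one]
  exact hF.summable_norm_profile hα0 hα1 N

lemma HasFracExpansion.continuous_torusPacket {α M D : ℝ} (hα0 : 0 ≤ α) (hα1 : α < 1)
    {F : ℝ → ℂ} (hF : HasFracExpansion α M D F) (N : ℕ) : Continuous (torusPacket N F) := by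
  refine continuous_tsum (fun n => by fun_prop) (hF.summable_norm_profile hα0 hα1 N) fun n x => ?_
  rw [norm_mul, norm_fourier_torus, mul_one]

lemma fourier_sub_torus (n : ℤ) (x y : Torus) :
    fourier n (x - y) = fourier n x * fourier n (-y) := by
  simp only [fourier_apply, sub_eq_add_neg, smul_add, AddCircle.toCircle_add, Circle.coe_mul]

lemma ae_haarAddCircle_of_ae_volume {p : Torus → Prop} (h : ∀ᵐ x ∂(volume : Measure Torus), p x) :
    ∀ᵐ x ∂(AddCircle.haarAddCircle : Measure Torus), p x := by
  rw [AddCircle.volume_eq_smul_haarAddCircle] at h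
  exact (Measure.ae_ennreal_smul_measure_iff (by simpa using Real.pi_pos)).1 h

lemma HasFracExpansion.fourierCoeff_eq {α M D : ℝ} (hα0 : 0 ≤ α) (hα1 : α < 1)
    {F : ℝ → ℂ} (hF : HasFracExpansion α M D F) (N : ℕ) (x₀ : Torus) {φ : L2 Torus}
    (hφ : (φ : Torus → ℂ) =ᵐ[volume] fun x => torusPacket N F (x - x₀)) (m : ℤ) :
    fourierCoeff (φ : Torus → ℂ) m = profile N F m * fourier m (-x₀) := by
  rw [fourierCoeff_congr_ae (ae_haarAddCircle_of_ae_volume hφ)]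
  set G : ℤ → Torus → ℂ := fun n x =>
    fourier (-m) x • (profile N F n * fourier n (-x₀) * fourier n x) with hG
  have hcont : ∀ n, Continuous (G n) := fun n => by
    simp only [hG, smul_eq_mul]
    fun_prop
  have hGn : ∀ n x, ‖G n x‖ = ‖profile N F n‖ := fun n x => by
    simp only [hG]
    rw [norm_smul, norm_mul, norm_mul, norm_fourier_torus, norm_fourier_torus, norm_fourier_torus,
      mul_one, mul_one, one_mul]
  have hint : ∀ n, Integrable (G n) AddCircle.haarAddCircle := fun n =>
    (hcont n).integrable_of_hasCompactSupport (HasCompactSupport.of_compactSpace _)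
  have hs := hasSum_integral_of_summable_integral_norm hint (by
    simp_rw [hGn]
    simpa using hF.summable_norm_profile hα0 hα1 N)
  have e1 : fourierCoeff (fun x => torusPacket N F (x - x₀)) m
      = ∫ x, ∑' n, G n x ∂AddCircle.haarAddCircle := by
    rw [fourierCoeff]
    refine integral_congr_ae (Eventually.of_forall fun x => ?_)
    simp only [torusPacket, hG, smul_eq_mul]
    rw [← tsum_mul_left]
    refine tsum_congr fun n => ?_
    rw [fourier_sub_torus]
    ring
  have e2 : ∀ n, ∫ x, G n x ∂AddCircle.haarAddCircle
      = if n = m then profile N F m * fourier m (-x₀) else 0 := fun n => by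
    have h1 : ∫ x, G n x ∂AddCircle.haarAddCircle
        = fourierCoeff (fun x => (profile N F n * fourier n (-x₀)) * fourier n x) m := rfl
    rw [h1, fourierCoeff.const_mul, fourierCoeff_fourier, Pi.single_apply]
    by_cases h : n = m
    · subst h
      simp
    · rw [if_neg h, if_neg (Ne.symm h), mul_zero]
  simp_rw [e2] at hs
  rw [e1, ← hs.tsum_eq, tsum_ite_eq]

/-- A coefficient is `(2π)⁻¹` times the inner product with a character, and all characters have the
same norm. A single coefficient therefore bounds the norm of a packet from below, uniformly in `N`.
-/
lemma exists_norm_fourierCoeff_le :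
    ∃ C : ℝ, 0 ≤ C ∧ ∀ (φ : L2 Torus) (n : ℤ), ‖fourierCoeff (φ : Torus → ℂ) n‖ ≤ C * ‖φ‖ := by
  have hmem : ∀ n : ℤ, MemLp (fun x : Torus => fourier n x) 2 volume := fun n =>
    MemLp.of_bound (fourier n).continuous.aestronglyMeasurable 1
      (Eventually.of_forall fun x => (norm_fourier_torus n x).le)
  refine ⟨(2 * Real.pi)⁻¹ * ‖(hmem 0).toLp‖, by positivity, fun φ n => ?_⟩
  have e : fourierCoeff (φ : Torus → ℂ) n
      = (2 * Real.pi)⁻¹ • inner ℂ ((hmem n).toLp) φ := by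
    rw [fourierCoeff, AddCircle.integral_haarAddCircle, L2.inner_def]
    congr 1
    refine integral_congr_ae ?_
    filter_upwards [(hmem n).coeFn_toLp] with x hx
    rw [hx, RCLike.inner_apply', fourier_neg]
    rfl
  have hle : ‖(hmem n).toLp‖ ≤ ‖(hmem 0).toLp‖ := by
    refine Lp.norm_le_norm_of_ae_le ?_
    filter_upwards [(hmem n).coeFn_toLp, (hmem 0).coeFn_toLp] with x h1 h2
    rw [h1, h2, norm_fourier_torus, norm_fourier_torus]
  rw [e, norm_smul, Real.norm_eq_abs, abs_of_pos (inv_pos.2 Real.two_pi_pos), mul_assoc]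
  gcongr
  exact (norm_inner_le_norm _ _).trans (by gcongr)

lemma isPacketSynthesis_torus {α : ℝ} (hα0 : 0 ≤ α) (hα1 : α < 1) {ω : Set Torus} {x₀ : Torus}
    {δ : ℝ} (hδ : 0 < δ) (hω : ∀ x ∈ ω, δ ≤ ‖x - x₀‖) :
    IsPacketSynthesis (IsFracLaplacianTorus α) ω (fun _ => 1) α
      (fun N F x => torusPacket N F (x - x₀)) where
  aestronglyMeasurable N M D F hF :=
    ((hF.continuous_torusPacket hα0 hα1 (N + 1)).comp
      (continuous_id.sub continuous_const)).aestronglyMeasurable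
  linear N F G H c hF hG hH x := by
    obtain ⟨_, _, hF⟩ := hF
    obtain ⟨_, _, hG⟩ := hG
    obtain ⟨_, _, hH⟩ := hH
    have sF := hF.summable_torusPacket hα0 hα1 (N + 1) (x - x₀)
    have sG := hG.summable_torusPacket hα0 hα1 (N + 1) (x - x₀)
    have sH := hH.summable_torusPacket hα0 hα1 (N + 1) (x - x₀)
    simp only [torusPacket]
    rw [← tsum_mul_left, ← sF.tsum_sub sG, ← (sF.sub sG).tsum_sub (sH.mul_left c)]
    refine tsum_congr fun n => ?_
    rw [profile_sub_sub]
    ring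
  stronglyMeasurable N a ha := by
    refine Measurable.stronglyMeasurable (Measurable.tsum fun n => ?_)
    refine Measurable.mul ?_ ?_
    · have := ha.measurable
      unfold profile fracExp
      by_cases hn : (n : ℝ) ∈ Ioi (0 : ℝ)
      · simp only [indicator_of_mem hn]
        fun_prop
      · simp only [indicator_of_notMem hn]
        fun_prop
    · have : Continuous fun q : ℝ × Torus => fourier n (q.2 - x₀) := by fun_prop
      exact this.measurable
  norm_le N M := by
    obtain ⟨C, hC0, hC⟩ := exists_norm_packet_le_global hα0 hα1 N M
    refine ⟨C * ∑' k : ℤ, (1 + (k : ℝ) ^ 2)⁻¹, by positivity, fun D F hF x => ?_⟩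
    obtain ⟨y, hy, hy'⟩ := exists_coe_eq_of_torus (x - x₀)
    rw [← hy, mul_one, ← mul_assoc]
    exact hF.norm_torusPacket_le hα0 hα1 N (hy'.trans_le (torus_norm_le_pi _))
      (mul_nonneg hF.1 hC0) fun y' _ => hC D F hF y'
  norm_le_of_mem := by
    obtain ⟨β, hβ, H⟩ := exists_norm_packet_le_of_le_abs hα0 hα1 hδ
    refine ⟨β, hβ, fun M => ?_⟩
    obtain ⟨C, hC0, hC⟩ := H M
    have hβ0 : 0 < β := zero_lt_one.trans hβ
    have hpos : 0 < ∑' k : ℤ, (1 + (k : ℝ) ^ 2)⁻¹ :=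
      summable_inv_one_add_int_sq.tsum_pos (fun k => by positivity) 0 (by norm_num)
    refine ⟨C * ∑' k : ℤ, (1 + (k : ℝ) ^ 2)⁻¹, by positivity, fun N F hF x hx => ?_⟩
    obtain ⟨y, hy, hy'⟩ := exists_coe_eq_of_torus (x - x₀)
    have hB0 : 0 ≤ C * ((N + 1).factorial / β ^ (N + 1 + 1)) := by positivity
    rw [← hy, mul_one, mul_right_comm]
    exact hF.norm_torusPacket_le hα0 hα1 N (hy'.trans_le (torus_norm_le_pi _)) hB0
      fun y' hyy' => hC N F hF y' (((hω x hx).trans_eq hy'.symm).trans hyy')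
  graph N a φ ψ hφ hψ n := by
    rw [(hasFracExpansion_fracExp α (le_refl ‖a‖)).fourierCoeff_eq hα0 hα1 (N + 1) x₀ hφ,
      (hasFracExpansion_rpowMulFracExp α (le_refl ‖a‖)).fourierCoeff_eq hα0 hα1 (N + 1) x₀ hψ,
      profile_rpowMulFracExp, mul_assoc]
  le_norm := by
    obtain ⟨C, hC0, hC⟩ := exists_norm_fourierCoeff_le
    -- `C` is only known to be nonnegative, hence `C + 1`. The coefficient used is the one at `n = N
    -- + 1`.
    refine ⟨(C + 1)⁻¹, by positivity, fun N a φ ha hφ => ?_⟩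
    have h1 := hC φ ((N + 1 : ℕ) : ℤ)
    rw [(hasFracExpansion_fracExp α (le_refl ‖a‖)).fourierCoeff_eq hα0 hα1 (N + 1) x₀ hφ, norm_mul,
      norm_fourier_torus, mul_one] at h1
    have h2 := packetMass_le_norm_profile hα0 ha (N + 1) (r := (((N + 1 : ℕ) : ℤ) : ℝ))
      (by push_cast; positivity) (by push_cast; exact le_rfl) (by push_cast; linarith)
    rw [inv_mul_le_iff₀ (by positivity)]
    nlinarith [norm_nonneg φ]

theorem not_nullControllable_torus {α : ℝ} (hα0 : 0 ≤ α) (hα1 : α < 1) {z : ℂ} (hz : 0 < z.re)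
    {ω : Set Torus} (hω : IsOpen ω) (hωc : (interior ωᶜ).Nonempty) {T : ℝ} (hT : 0 < T) :
    ¬ NullControllable (IsFracLaplacianTorus α) z ω T := by
  obtain ⟨x₀, hx₀⟩ := hωc
  obtain ⟨δ, hδ, hball⟩ := Metric.isOpen_iff.1 isOpen_interior x₀ hx₀
  refine (isPacketSynthesis_torus (x₀ := x₀) hα0 hα1 hδ fun x hx => ?_).not_nullControllable hα0 hα1
    hω.measurableSet (memLp_const 1) (fun x => zero_le_one) hz hT
  by_contra hlt
  exact interior_subset (hball (by rwa [Metric.mem_ball, dist_eq_norm, ← not_le])) hx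

end TorusSynthesis

theorem mainTheorem2 (α : ℝ) (hα0 : 0 ≤ α) (hα1 : α < 1) (z : ℂ) (hz : 0 < z.re) :
    (∀ ω : Set ℝ, IsOpen ω → (interior ωᶜ).Nonempty →
      ∀ T : ℝ, 0 < T → ¬ NullControllable (IsFracLaplacianReal α) z ω T) ∧
    (∀ ω : Set Torus, IsOpen ω → (interior ωᶜ).Nonempty →
      ∀ T : ℝ, 0 < T → ¬ NullControllable (IsFracLaplacianTorus α) z ω T) :=
  ⟨fun _ hω hωc _ hT => not_nullControllable_real hα0 hα1 hz hω hωc hT,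
    fun _ hω hωc _ hT => not_nullControllable_torus hα0 hα1 hz hω hωc hT⟩
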